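/- Let $D,d\ge 1$ be integers and let $G=(V,E)$ be a finite, non-empty, simple $D$-regular graph with $n=|V|$ vertices. Place a $d$-dimensional particle (qudit) at each vertex, so that the total Hilbert space is $(\mathbb{C}^d)^{\otimes n}$. For every edge $\{i,j\}\in E$ let $H_{i,j}$ be a Hermitian operator on $(\mathbb{C}^d)^{\otimes n}$ that acts only on the qudits $i$ and $j$ (that is, it is the tensor product of an operator on these two qudits with the identity on the others) and has operator norm $\|H_{i,j}\|\le 1$. Let $$H=\mathop{\mathbb{E}}_{\{i,j\}\in E}H_{i,j}=\frac{2}{nD}\sum_{\{i,j\}\in E}H_{i,j},$$ the sum being over unordered edges, and let $e_0(H)=\min\{\langle\psi|H|\psi\rangle:\langle\psi|\psi\rangle=1\}$ be the ground-state energy of $H$. Then there are unit vectors $|\varphi_v\rangle\in\mathbb{C}^d$, $v\in V$, such that the product state $|\varphi\rangle=\bigotimes_{v\in V}|\varphi_v\rangle$, with density matrix $\varphi=|\varphi\rangle\langle\varphi|$, satisfies $$\operatorname{tr}(H\varphi)\le e_0(H)+12\left(\frac{d^2\ln d}{D}\right)^{1/3}.$$ -/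

import Mathlib

noncomputable section

/-- The Hilbert space of one `d`-dimensional particle at each site `v : V`, i.e. the tensor product
of copies of `ℂ^d` over `V`, in coordinates with respect to the product basis, which is indexed by
the configurations `x : V → Fin d`. -/
abbrev QuditSpace (V : Type*) [Fintype V] (d : ℕ) := EuclideanSpace ℂ (V → Fin d)

/-- Operators on `QuditSpace V d`, as matrices in the product basis. -/
abbrev QuditOp (V : Type*) (d : ℕ) := Matrix (V → Fin d) (V → Fin d) ℂ

/-- The operator norm (largest singular value) of a matrix, for the Euclidean norm on vectors. -/
def opNorm {V : Type*} [Fintype V] [DecidableEq V] {d : ℕ} (A : QuditOp V d) : ℝ :=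
  ‖Matrix.toEuclideanCLM (𝕜 := ℂ) A‖

open Classical in
/-- `A` acts only on the qudits in `S`: it is `K ⊗ I` for some operator `K` on the qudits in `S`,
where `I` is the identity on the other qudits. -/
def ActsOnlyOn {V : Type*} {d : ℕ} (S : Set V) (A : QuditOp V d) : Prop :=
  ∃ K : Matrix (S → Fin d) (S → Fin d) ℂ, ∀ x y : V → Fin d,
    A x y = if ∀ v, v ∉ S → x v = y v then K (fun s => x s) (fun s => y s) else 0

/-- The Hamiltonian `𝔼_{e ∈ E} h e`: the average of the terms `h e` over the (unordered) edges `e`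
of `G`. -/
def edgeAverage {V : Type*} [Fintype V] [DecidableEq V] (G : SimpleGraph V) [DecidableRel G.Adj]
    {d : ℕ} (h : Sym2 V → QuditOp V d) : QuditOp V d :=
  (1 / (G.edgeFinset.card : ℂ)) • ∑ e ∈ G.edgeFinset, h e

/-- On a `D`-regular graph with `n` vertices the average over the edges is `2 / (n D)` times
the sum over the edges. -/
theorem edgeAverage_eq {V : Type*} [Fintype V] [DecidableEq V] (G : SimpleGraph V)
    [DecidableRel G.Adj] {d D : ℕ} (hG : G.IsRegularOfDegree D) (h : Sym2 V → QuditOp V d) :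
    edgeAverage G h
      = (2 / ((Fintype.card V : ℂ) * (D : ℂ))) • ∑ e ∈ G.edgeFinset, h e := by
  have h1 : Fintype.card V * D = 2 * G.edgeFinset.card := by
    rw [← G.sum_degrees_eq_twice_card_edges]
    simp [hG.degree_eq]
  have h2 : (Fintype.card V : ℂ) * (D : ℂ) = 2 * (G.edgeFinset.card : ℂ) := by
    exact_mod_cast h1
  rw [edgeAverage, h2, ← div_div, div_self two_ne_zero]

/-- The expectation `⟨ψ|H|ψ⟩` (its real part; it is real when `H` is Hermitian). -/
def expectation {V : Type*} [Fintype V] [DecidableEq V] {d : ℕ}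
    (H : QuditOp V d) (ψ : QuditSpace V d) : ℝ :=
  (inner ℂ ψ (Matrix.toEuclideanCLM (𝕜 := ℂ) H ψ)).re

/-- The ground-state energy `e₀(H) = min {⟨ψ|H|ψ⟩ : ⟨ψ|ψ⟩ = 1}`. -/
def groundEnergy {V : Type*} [Fintype V] [DecidableEq V] {d : ℕ} (H : QuditOp V d) : ℝ :=
  sInf (expectation H '' {ψ : QuditSpace V d | ‖ψ‖ = 1})

/-- The infimum that defines the ground-state energy is a minimum. -/
theorem isLeast_groundEnergy {V : Type*} [Fintype V] [DecidableEq V] {d : ℕ} (hd : 0 < d)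
    (H : QuditOp V d) :
    IsLeast (expectation H '' {ψ : QuditSpace V d | ‖ψ‖ = 1}) (groundEnergy H) := by
  have hs : {ψ : QuditSpace V d | ‖ψ‖ = 1} = Metric.sphere 0 1 := by
    ext ψ; simp
  have hc : Continuous (expectation H) := by
    unfold expectation
    fun_prop
  refine IsCompact.isLeast_sInf ?_ ?_
  · rw [hs]
    exact (isCompact_sphere _ _).image hc
  · exact ⟨_, EuclideanSpace.single (fun _ => ⟨0, hd⟩) 1, by simp, rfl⟩

/-- The product vector `⊗_v φ_v`. -/
def productVector {V : Type*} [Fintype V] {d : ℕ} (φ : V → EuclideanSpace ℂ (Fin d)) :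
    QuditSpace V d :=
  WithLp.toLp 2 (fun x => ∏ v, φ v (x v))

/-- The density matrix `|ψ⟩⟨ψ|` of a vector `ψ`. -/
def pureDensity {V : Type*} [Fintype V] {d : ℕ} (ψ : QuditSpace V d) : QuditOp V d :=
  Matrix.of fun x y => ψ x * star (ψ y)

end

/-! The ground state is traded for a classical probability distribution whose pairwise correlations
are then removed by conditioning. Every particle is measured with the rank-one measurement
`phaseVec`, whose projections span all one-particle operators. An explicit dual frame
(`sum_dual_phaseVec`) writes each edge term as a combination of products of these projections, so
its energy in any state is the mean of a function `h (x i) (x j)` of the outcomes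
(`expectation_eq_of_isDual`).

Fix a set `C` of sites and condition on its outcomes `z`. Let each site independently take the pure
state left when all other particles are measured, with outcomes drawn given `z`. For `i, j ∉ C` this
random product state gives the outcome law `condProd`: `i` and `j` become independent given `z`,
with unchanged marginals (`mixAvg_two_site`). The energy change on such an edge is controlled by the
conditional mutual information through the Hellinger distance and Cauchy-Schwarz
(`sum_condProd_sub_le_sqrt_condMutualInfo`). Only second moments of `h` enter, and these are at most
`24 d ^ 2` in every state (`sum_normSq_phaseCoeff_mul_le`), which is where the factor `d ^ 2` comes
from.

The set `C` grows greedily. The potential is the sum over sites of the information between that site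
and `C`; it is at most `n log d`, however many outcomes there are (`siteInfo_le_log`). By the chain
rule, adding a suitable site raises it by at least `2 / n` times the sum of the edge informations
(`exists_chain_pairInfo`), so at some stage the edges carry little information on average. Edges
meeting `C` are given up at cost 2 each. Averaging over the stages balances the two losses
(`exists_lt_loss_le`), and the number of stages is chosen to equalise them up to constants, which
produces the cube root. -/

section

/-! ### Second and fourth moments of vectors of phases -/

open Complex ComplexConjugate

/-- The fourth root of unity `i ^ k`. -/
noncomputable def phase (k : Fin 4) : ℂ := I ^ (k : ℕ)

theorem phase_add_one (k : Fin 4) : phase (k + 1) = I * phase k := by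
  fin_cases k <;> simp [phase, Fin.add_def, pow_succ]

theorem normSq_phase (k : Fin 4) : normSq (phase k) = 1 := by
  simp [phase]

theorem conj_phase_mul_phase (k : Fin 4) : conj (phase k) * phase k = 1 := by
  rw [← normSq_eq_conj_mul_self, normSq_phase, ofReal_one]

theorem sum_phase : ∑ k, phase k = 0 := by
  simp [phase, Fin.sum_univ_four, pow_succ]

theorem sum_phase_sq : ∑ k, phase k * phase k = 0 := by
  simp [phase, Fin.sum_univ_four, pow_succ]

/-- Multiplying the coordinate `b` by `I` permutes the phase vectors and, off the diagonal,
multiplies the sum by `I`; hence the sum vanishes. -/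
theorem sum_conj_phase_mul_phase {d : ℕ} (a b : Fin d) :
    ∑ x : Fin d → Fin 4, conj (phase (x a)) * phase (x b) = if a = b then 4 ^ d else 0 := by
  split_ifs with hab
  · subst hab
    simp [conj_phase_mul_phase]
  · have h1 : ∑ x : Fin d → Fin 4, conj (phase (x a)) * phase (x b)
        = I * ∑ x : Fin d → Fin 4, conj (phase (x a)) * phase (x b) := by
      conv_lhs => rw [← Equiv.sum_comp (Equiv.addRight (Pi.single b (1 : Fin 4)))]
      rw [Finset.mul_sum]
      refine Finset.sum_congr rfl fun x _ => ?_
      simp only [Equiv.coe_addRight, Pi.add_apply, Pi.single_eq_same, phase_add_one,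
        Pi.single_eq_of_ne hab, add_zero]
      ring
    have h2 : (1 - I) * ∑ x : Fin d → Fin 4, conj (phase (x a)) * phase (x b) = 0 := by
      linear_combination h1
    rcases mul_eq_zero.mp h2 with h3 | h3
    · have := congrArg Complex.re h3
      simp at this
    · exact h3

/-- The inner product of the vector of phases `x` with `c`. -/
noncomputable def phaseDot {d : ℕ} (x : Fin d → Fin 4) (c : Fin d → ℂ) : ℂ :=
  ∑ a, conj (phase (x a)) * c a

theorem sum_normSq_of_orthogonal {ι κ : Type*} [Fintype ι] [Fintype κ] [DecidableEq κ]
    (f : ι → κ → ℂ) (N : ℝ) (hf : ∀ a b, ∑ x, f x a * conj (f x b) = if a = b then (N : ℂ) else 0)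
    (c : κ → ℂ) : ∑ x, normSq (∑ a, f x a * c a) = N * ∑ a, normSq (c a) := by
  apply ofReal_injective
  push_cast
  simp only [← mul_conj, map_sum, map_mul, Finset.sum_mul_sum]
  rw [Finset.sum_comm, Finset.mul_sum]
  refine Finset.sum_congr rfl fun a _ => ?_
  rw [Finset.sum_comm]
  have : ∀ b, ∑ x, f x a * c a * (conj (f x b) * conj (c b))
      = (if a = b then (N : ℂ) else 0) * (c a * conj (c b)) := fun b => by
    rw [← hf, Finset.sum_mul]
    exact Finset.sum_congr rfl fun x _ => by ring
  simp [this]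

theorem sum_normSq_phaseDot {d : ℕ} (c : Fin d → ℂ) :
    ∑ x, normSq (phaseDot x c) = 4 ^ d * ∑ a, normSq (c a) := by
  refine sum_normSq_of_orthogonal (fun (x : Fin d → Fin 4) a => conj (phase (x a))) (4 ^ d)
    (fun a b => ?_) c
  simpa using sum_conj_phase_mul_phase a b

theorem sum_normSq_phase_mul {d : ℕ} (c : Fin d → ℂ) :
    ∑ x : Fin d → Fin 4, normSq (∑ a, phase (x a) * c a) = 4 ^ d * ∑ a, normSq (c a) := by
  refine sum_normSq_of_orthogonal (fun (x : Fin d → Fin 4) a => phase (x a)) (4 ^ d)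
    (fun a b => ?_) c
  have := sum_conj_phase_mul_phase b a
  simp only [eq_comm (a := b)] at this
  simpa [mul_comm] using this

theorem sum_phase_normSq_add_sq (s a : ℂ) :
    ∑ k, normSq (conj (phase k) * a + s) ^ 2
      = 4 * (normSq s ^ 2 + 4 * normSq s * normSq a + normSq a ^ 2) := by
  simp only [phase, Fin.sum_univ_four, normSq_apply]
  simp [pow_succ]
  ring

/-- Induction on the number of coordinates: averaging over the first phase leaves `S ^ 2 + 4 S a + a
^ 2`, and the cross coefficient 4 is exactly the one in `2 (S + a) ^ 2`. -/
theorem sum_normSq_phaseDot_sq_le {d : ℕ} (c : Fin d → ℂ) :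
    ∑ x, normSq (phaseDot x c) ^ 2 ≤ 2 * 4 ^ d * (∑ a, normSq (c a)) ^ 2 := by
  induction d with
  | zero => simp [phaseDot]
  | succ d ih =>
    have h1 := ih (fun a => c a.succ)
    have h2 := sum_normSq_phaseDot (fun a => c a.succ)
    rw [← Equiv.sum_comp (Fin.consEquiv fun _ => Fin 4), Fintype.sum_prod_type_right]
    have h3 : ∀ x : Fin d → Fin 4, ∑ k : Fin 4,
        normSq (phaseDot ((Fin.consEquiv fun _ => Fin 4) (k, x)) c) ^ 2
        = 4 * (normSq (phaseDot x fun a => c a.succ) ^ 2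
          + 4 * normSq (phaseDot x fun a => c a.succ) * normSq (c 0) + normSq (c 0) ^ 2) := by
      intro x
      rw [← sum_phase_normSq_add_sq]
      simp [phaseDot, Fin.sum_univ_succ, Fin.consEquiv]
    simp only [h3]
    rw [← Finset.mul_sum, Finset.sum_add_distrib, Finset.sum_add_distrib, ← Finset.sum_mul,
      ← Finset.mul_sum, h2, Fin.sum_univ_succ]
    simp only [Finset.sum_const, Finset.card_univ, Fintype.card_fun, Fintype.card_fin, nsmul_eq_mul]
    push_cast
    have h4 : (0 : ℝ) ≤ 4 ^ d * normSq (c 0) ^ 2 := by positivity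
    rw [pow_succ (4 : ℝ) d]
    nlinarith

theorem sum_normSq_phaseDot_mul_le {d : ℕ} (c e : Fin d → ℂ) :
    ∑ x, normSq (phaseDot x c) * normSq (phaseDot x e)
      ≤ 2 * 4 ^ d * (∑ a, normSq (c a)) * ∑ a, normSq (e a) := by
  have hc : 0 ≤ ∑ a, normSq (c a) := Finset.sum_nonneg fun _ _ => normSq_nonneg _
  have he : 0 ≤ ∑ a, normSq (e a) := Finset.sum_nonneg fun _ _ => normSq_nonneg _
  refine le_of_sq_le_sq ?_ (by positivity)
  calc _ ≤ _ := Finset.sum_mul_sq_le_sq_mul_sq _ _ _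
    _ ≤ (2 * 4 ^ d * (∑ a, normSq (c a)) ^ 2) * (2 * 4 ^ d * (∑ a, normSq (e a)) ^ 2) := by
      gcongr
      · exact sum_normSq_phaseDot_sq_le c
      · exact sum_normSq_phaseDot_sq_le e
    _ = _ := by ring

/-- The inner product of the product `x ⊗ y` of two vectors of phases with `χ`. -/
noncomputable def phaseDotTwo {d : ℕ} (x y : Fin d → Fin 4) (χ : Fin d → Fin d → ℂ) : ℂ :=
  phaseDot x fun a => phaseDot y (χ a)

theorem phaseDotTwo_comm {d : ℕ} (x y : Fin d → Fin 4) (χ : Fin d → Fin d → ℂ) :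
    phaseDotTwo x y χ = phaseDot y fun b => phaseDot x fun a => χ a b := by
  simp only [phaseDotTwo, phaseDot, Finset.mul_sum]
  rw [Finset.sum_comm]
  exact Finset.sum_congr rfl fun _ _ => Finset.sum_congr rfl fun _ _ => by ring

theorem sum_normSq_phaseDotTwo {d : ℕ} (χ : Fin d → Fin d → ℂ) :
    ∑ x, ∑ y, normSq (phaseDotTwo x y χ) = 4 ^ d * 4 ^ d * ∑ a, ∑ b, normSq (χ a b) := by
  simp only [phaseDotTwo]
  rw [Finset.sum_comm]
  simp only [sum_normSq_phaseDot]
  rw [← Finset.mul_sum, Finset.sum_comm]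
  simp only [sum_normSq_phaseDot]
  rw [← Finset.mul_sum, mul_assoc]

/-- The action of a two-particle operator with matrix elements `⟨a b|K|a' b'⟩ = K a b a' b'`. -/
def applyTwo {d : ℕ} (K : Fin d → Fin d → Fin d → Fin d → ℂ) (χ : Fin d → Fin d → ℂ)
    (a b : Fin d) : ℂ :=
  ∑ a', ∑ b', K a b a' b' * χ a' b'

/-- The matrix element of `K` between two products of vectors of phases. -/
noncomputable def phaseElement {d : ℕ} (K : Fin d → Fin d → Fin d → Fin d → ℂ)
    (x x' y y' : Fin d → Fin 4) : ℂ :=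
  phaseDotTwo x x' (applyTwo K fun a b => phase (y a) * phase (y' b))

theorem phaseElement_eq {d : ℕ} (K : Fin d → Fin d → Fin d → Fin d → ℂ)
    (x x' y y' : Fin d → Fin 4) :
    phaseElement K x x' y y' = ∑ p : Fin d × Fin d, ∑ q : Fin d × Fin d,
      conj (phase (x p.1)) * conj (phase (x' p.2)) *
      K p.1 p.2 q.1 q.2 * phase (y q.1) * phase (y' q.2) := by
  simp only [phaseElement, phaseDotTwo, phaseDot, applyTwo, Finset.mul_sum,
    Fintype.sum_prod_type]
  exact Finset.sum_congr rfl fun _ _ => Finset.sum_congr rfl fun _ _ =>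
    Finset.sum_congr rfl fun _ _ => Finset.sum_congr rfl fun _ _ => by ring

/-! ### Weighted second moments of the matrix elements of a contraction -/

section SecondMoment

variable {d : ℕ} {K : Fin d → Fin d → Fin d → Fin d → ℂ}

theorem conj_phaseElement (hK : ∀ a b a' b', conj (K a b a' b') = K a' b' a b)
    (x x' y y' : Fin d → Fin 4) :
    conj (phaseElement K x x' y y') = phaseElement K y y' x x' := by
  simp only [phaseElement_eq, map_sum, map_mul, hK, conj_conj]
  rw [Finset.sum_comm]
  exact Finset.sum_congr rfl fun _ _ => Finset.sum_congr rfl fun _ _ => by ring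

theorem normSq_phaseElement_comm (hK : ∀ a b a' b', conj (K a b a' b') = K a' b' a b)
    (x x' y y' : Fin d → Fin 4) :
    normSq (phaseElement K x x' y y') = normSq (phaseElement K y y' x x') := by
  rw [← conj_phaseElement hK, normSq_conj]

theorem sum_normSq_phase_phase (y y' : Fin d → Fin 4) :
    ∑ a, ∑ b, normSq (phase (y a) * phase (y' b)) = (d : ℝ) ^ 2 := by
  simp [normSq_phase, sq]

/-- The weight depends only on `x, x'`, which lie on one side of `K`. Orthogonality sums out `y, y'`
and leaves the squared norm of `K` applied to `x ⊗ x'`, at most `d ^ 2`. -/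
theorem sum_normSq_phaseElement_mul_le_left
    (hK : ∀ a b a' b', conj (K a b a' b') = K a' b' a b)
    (hK1 : ∀ χ, ∑ a, ∑ b, normSq (applyTwo K χ a b) ≤ ∑ a, ∑ b, normSq (χ a b))
    (χ : Fin d → Fin d → ℂ) :
    ∑ x, ∑ x', ∑ y, ∑ y', normSq (phaseElement K x x' y y') * normSq (phaseDotTwo x x' χ)
      ≤ 4 ^ d * 4 ^ d * (d : ℝ) ^ 2 * (4 ^ d * 4 ^ d * ∑ a, ∑ b, normSq (χ a b)) := by
  rw [← sum_normSq_phaseDotTwo, Finset.mul_sum]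
  refine Finset.sum_le_sum fun x _ => ?_
  rw [Finset.mul_sum]
  refine Finset.sum_le_sum fun x' _ => ?_
  simp only [← Finset.sum_mul]
  refine mul_le_mul_of_nonneg_right ?_ (normSq_nonneg _)
  simp only [normSq_phaseElement_comm hK x x']
  simp only [phaseElement, sum_normSq_phaseDotTwo]
  gcongr
  exact (hK1 _).trans (sum_normSq_phase_phase _ _).le

/-- Puts the element in a form where `x'` and `y` can be summed out by orthogonality while `x` and
`y'` stay fixed; the inner two-particle vector is a basis vector tensored with `y'`. -/
theorem phaseElement_eq_phaseDot (x x' y y' : Fin d → Fin 4) :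
    phaseElement K x x' y y' = phaseDot x' fun b => ∑ a', phase (y a') *
      phaseDot x fun a => applyTwo K (fun s t => if s = a' then phase (y' t) else 0) a b := by
  rw [phaseElement, phaseDotTwo_comm]
  congr 1
  ext b
  simp only [phaseDot, applyTwo, Finset.mul_sum, mul_ite, mul_zero]
  rw [Finset.sum_comm]
  refine Finset.sum_congr rfl fun a' _ => Finset.sum_congr rfl fun a _ => ?_
  rw [Finset.sum_comm]
  refine Finset.sum_congr rfl fun b' _ => ?_
  simp only [Finset.sum_ite_eq', Finset.mem_univ, if_true]
  ring

/-- Here the weight involves `x` and `y'`, on opposite sides of `K`. After `x'` and `y` are summed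
out, two quadratic factors in `x` remain, and the fourth moment bound costs the factor 2. The `d`
vectors `e_{a'} ⊗ y'` have squared norm `d` each, so again `d ^ 2` in total. -/
theorem sum_normSq_phaseElement_mul_le_mixed
    (hK1 : ∀ χ, ∑ a, ∑ b, normSq (applyTwo K χ a b) ≤ ∑ a, ∑ b, normSq (χ a b))
    (χ : Fin d → Fin d → ℂ) :
    ∑ y', ∑ x, ∑ y, ∑ x', normSq (phaseElement K x x' y y') * normSq (phaseDotTwo x y' χ)
      ≤ 2 * (4 ^ d * 4 ^ d * (d : ℝ) ^ 2 * (4 ^ d * 4 ^ d * ∑ a, ∑ b, normSq (χ a b))) := by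
  have h1 : ∀ y' : Fin d → Fin 4, ∑ x, ∑ y, ∑ x',
      normSq (phaseElement K x x' y y') * normSq (phaseDotTwo x y' χ)
      ≤ 2 * 4 ^ d * 4 ^ d * 4 ^ d * (d : ℝ) ^ 2 * ∑ a, normSq (phaseDot y' (χ a)) := by
    intro y'
    have he : 0 ≤ ∑ a, normSq (phaseDot y' (χ a)) :=
      Finset.sum_nonneg fun _ _ => normSq_nonneg _
    simp only [← Finset.sum_mul, phaseElement_eq_phaseDot, sum_normSq_phaseDot]
    simp only [← Finset.mul_sum]
    have h2 : ∀ x : Fin d → Fin 4, ∑ y : Fin d → Fin 4, ∑ b, normSq (∑ a', phase (y a') *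
        phaseDot x fun a => applyTwo K (fun s t => if s = a' then phase (y' t) else 0) a b)
        = 4 ^ d * ∑ b, ∑ a', normSq (phaseDot x fun a =>
          applyTwo K (fun s t => if s = a' then phase (y' t) else 0) a b) := by
      intro x
      rw [Finset.sum_comm]
      simp only [sum_normSq_phase_mul]
      rw [Finset.mul_sum]
    simp only [h2, phaseDotTwo]
    calc _ = 4 ^ d * 4 ^ d * ∑ b, ∑ a', ∑ x, normSq (phaseDot x fun a =>
          applyTwo K (fun s t => if s = a' then phase (y' t) else 0) a b) *
          normSq (phaseDot x fun a => phaseDot y' (χ a)) := by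
          simp only [mul_assoc, Finset.mul_sum, Finset.sum_mul]
          rw [Finset.sum_comm]
          refine Finset.sum_congr rfl fun b _ => ?_
          rw [Finset.sum_comm]
      _ ≤ 4 ^ d * 4 ^ d * ∑ b, ∑ a', 2 * 4 ^ d * (∑ a, normSq
          (applyTwo K (fun s t => if s = a' then phase (y' t) else 0) a b)) *
          ∑ a, normSq (phaseDot y' (χ a)) := by
          gcongr
          exact sum_normSq_phaseDot_mul_le _ _
      _ = 2 * 4 ^ d * 4 ^ d * 4 ^ d * (∑ a' : Fin d, ∑ a, ∑ b, normSq
          (applyTwo K (fun s t => if s = a' then phase (y' t) else 0) a b)) *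
          ∑ a, normSq (phaseDot y' (χ a)) := by
          simp only [← Finset.sum_mul, ← Finset.mul_sum]
          rw [Finset.sum_comm]
          have : ∀ a' : Fin d, ∑ b, ∑ a, normSq (applyTwo K
              (fun s t => if s = a' then phase (y' t) else 0) a b) = ∑ a, ∑ b, normSq
              (applyTwo K (fun s t => if s = a' then phase (y' t) else 0) a b) :=
            fun a' => Finset.sum_comm
          simp only [this]
          ring
      _ ≤ 2 * 4 ^ d * 4 ^ d * 4 ^ d * (∑ a' : Fin d, (d : ℝ)) *
          ∑ a, normSq (phaseDot y' (χ a)) := by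
          gcongr with a' _
          refine (hK1 _).trans (le_of_eq ?_)
          rw [Finset.sum_comm]
          simp [apply_ite normSq, normSq_phase]
      _ = _ := by
          simp only [Finset.sum_const, Finset.card_univ, Fintype.card_fin, nsmul_eq_mul]
          ring
  refine (Finset.sum_le_sum fun y' _ => h1 y').trans (le_of_eq ?_)
  rw [← Finset.mul_sum, Finset.sum_comm]
  simp only [sum_normSq_phaseDot]
  rw [← Finset.mul_sum]
  ring

end SecondMoment

end

/-! ### The one-particle measurement and its dual frame -/

section

open Complex ComplexConjugate

/-- The outcomes of the measurement of one particle: two vectors of phases and a relative phase. -/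
abbrev PhaseOutcome (d : ℕ) := (Fin d → Fin 4) × (Fin d → Fin 4) × Fin 4

/-- The normalisation of the vectors `phaseVec`. -/
noncomputable def phaseNorm (d : ℕ) : ℝ := √(1 / (8 * (4 ^ d * 4 ^ d)))

theorem phaseNorm_mul_self (d : ℕ) : phaseNorm d * phaseNorm d = 1 / (8 * (4 ^ d * 4 ^ d)) :=
  Real.mul_self_sqrt (by positivity)

theorem ofReal_phaseNorm_mul_self (d : ℕ) :
    (phaseNorm d : ℂ) * phaseNorm d = 1 / (8 * (4 ^ d * 4 ^ d)) := by
  rw [← ofReal_mul, phaseNorm_mul_self]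
  push_cast
  rfl

/-- The rank-one measurement `∑ o, |m o⟩⟨m o| = 1` given by superpositions of two vectors of
phases. -/
noncomputable def phaseVec {d : ℕ} (o : PhaseOutcome d) (a : Fin d) : ℂ :=
  phaseNorm d * (phase (o.1 a) + phase o.2.2 * phase (o.2.1 a))

theorem sum_conj_phase : ∑ k, conj (phase k) = 0 := by
  rw [← map_sum, sum_phase, map_zero]

theorem sum_comm_pairs {α β γ δ M : Type*} [Fintype α] [Fintype β] [Fintype γ] [Fintype δ]
    [AddCommMonoid M] (f : α → β → γ → δ → M) :
    ∑ a, ∑ b, ∑ c, ∑ d, f a b c d = ∑ c, ∑ d, ∑ a, ∑ b, f a b c d := by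
  calc _ = ∑ p : α × β, ∑ q : γ × δ, f p.1 p.2 q.1 q.2 := by simp only [Fintype.sum_prod_type]
    _ = ∑ q : γ × δ, ∑ p : α × β, f p.1 p.2 q.1 q.2 := Finset.sum_comm
    _ = _ := by simp only [Fintype.sum_prod_type]

theorem sum_phase_mul_conj_phase {d : ℕ} (a b : Fin d) :
    ∑ x : Fin d → Fin 4, phase (x a) * conj (phase (x b)) = if a = b then 4 ^ d else 0 := by
  rw [← Finset.sum_congr rfl fun _ _ => mul_comm _ _, sum_conj_phase_mul_phase]
  simp only [eq_comm]

theorem sum_phaseVec_mul_conj {d : ℕ} (a b : Fin d) :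
    ∑ o, phaseVec o a * conj (phaseVec o b) = if a = b then 1 else 0 := by
  have h1 : ∀ x y : Fin d → Fin 4, ∑ w, phaseVec (x, y, w) a * conj (phaseVec (x, y, w) b)
      = phaseNorm d * phaseNorm d * 4 * (phase (x a) * conj (phase (x b)))
        + phaseNorm d * phaseNorm d * 4 * (phase (y a) * conj (phase (y b))) := by
    intro x y
    calc _ = ∑ w, (phaseNorm d * phaseNorm d * (phase (x a) * conj (phase (x b)))
          + phaseNorm d * phaseNorm d * (phase (y a) * conj (phase (y b)))
            * (conj (phase w) * phase w)
          + phaseNorm d * phaseNorm d * (phase (y a) * conj (phase (x b))) * phase w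
          + phaseNorm d * phaseNorm d * (phase (x a) * conj (phase (y b))) * conj (phase w)) :=
        Finset.sum_congr rfl fun w _ => by
          simp only [phaseVec, map_mul, map_add, conj_ofReal]
          ring
      _ = _ := by
        simp only [Finset.sum_add_distrib, ← Finset.mul_sum, sum_phase, sum_conj_phase,
          conj_phase_mul_phase]
        simp
        ring
  simp only [Fintype.sum_prod_type, h1, Finset.sum_add_distrib, Finset.sum_const,
    Finset.card_univ, Fintype.card_fun, Fintype.card_fin, nsmul_eq_mul,
    ofReal_phaseNorm_mul_self]
  simp only [← Finset.mul_sum, sum_phase_mul_conj_phase]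
  split_ifs
  · push_cast
    field_simp
    norm_num
  · simp

/-- The factor `phase o.2.2` survives summation over the relative phase only against the cross term
`|x⟩⟨y|` of the projection; orthogonality in `x` and `y` then isolates one matrix entry. The other
terms contain `∑ w` or `∑ w ^ 2`, both zero. -/
theorem sum_dual_phaseVec {d : ℕ} (s t a b : Fin d) :
    ∑ o : PhaseOutcome d, 2 * phase o.2.2 * (conj (phase (o.1 s)) * phase (o.2.1 t)) *
      (phaseVec o a * conj (phaseVec o b)) = if s = a ∧ t = b then 1 else 0 := by
  have h1 : ∀ x y : Fin d → Fin 4, ∑ w, 2 * phase w * (conj (phase (x s)) * phase (y t)) *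
      (phaseVec (x, y, w) a * conj (phaseVec (x, y, w) b))
      = phaseNorm d * phaseNorm d * 8 * ((conj (phase (x s)) * phase (x a)) *
        (phase (y t) * conj (phase (y b)))) := by
    intro x y
    calc _ = ∑ w, (2 * phaseNorm d * phaseNorm d * ((conj (phase (x s)) * phase (x a)) *
            (phase (y t) * conj (phase (y b)))) * (conj (phase w) * phase w)
          + 2 * phaseNorm d * phaseNorm d * conj (phase (x s)) * phase (y t) *
            (phase (x a) * conj (phase (x b))) * phase w
          + 2 * phaseNorm d * phaseNorm d * conj (phase (x s)) * phase (y t) *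
            (phase (y a) * conj (phase (y b))) * (conj (phase w) * phase w) * phase w
          + 2 * phaseNorm d * phaseNorm d * conj (phase (x s)) * phase (y t) *
            (phase (y a) * conj (phase (x b))) * (phase w * phase w)) :=
        Finset.sum_congr rfl fun w _ => by
          simp only [phaseVec, map_mul, map_add, conj_ofReal]
          ring
      _ = _ := by
        simp only [Finset.sum_add_distrib, ← Finset.mul_sum, sum_phase, sum_phase_sq,
          conj_phase_mul_phase, mul_one]
        simp
        ring
  simp only [Fintype.sum_prod_type, h1, ← Finset.mul_sum, ← Finset.sum_mul,
    sum_phase_mul_conj_phase, sum_conj_phase_mul_phase, ofReal_phaseNorm_mul_self]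
  by_cases h2 : s = a <;> by_cases h3 : t = b <;> simp [h2, h3]
  field_simp

/-- The inner product of `m o ⊗ m o'` with `χ`. -/
def overlapTwo {Ω : Type*} {d : ℕ} (m : Ω → Fin d → ℂ) (o o' : Ω) (χ : Fin d → Fin d → ℂ) : ℂ :=
  ∑ a, ∑ b, conj (m o a) * conj (m o' b) * χ a b

theorem overlapTwo_phaseVec {d : ℕ} (x y x' y' : Fin d → Fin 4) (w w' : Fin 4)
    (χ : Fin d → Fin d → ℂ) : overlapTwo phaseVec (x, y, w) (x', y', w') χ
      = phaseNorm d * phaseNorm d * ((phaseDotTwo x x' χ + conj (phase w) * phaseDotTwo y x' χ)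
        + conj (phase w') * (phaseDotTwo x y' χ + conj (phase w) * phaseDotTwo y y' χ)) := by
  simp only [overlapTwo, phaseVec, phaseDotTwo, phaseDot, Finset.mul_sum, ← Finset.sum_add_distrib,
    map_mul, map_add, conj_ofReal]
  exact Finset.sum_congr rfl fun _ _ => Finset.sum_congr rfl fun _ _ => by ring

theorem sum_normSq_add_phase_mul (s a : ℂ) :
    ∑ k, normSq (s + conj (phase k) * a) = 4 * (normSq s + normSq a) := by
  simp only [phase, Fin.sum_univ_four, normSq_apply]
  simp [pow_succ]
  ring

theorem sum_normSq_overlapTwo_phaseVec {d : ℕ} (x y x' y' : Fin d → Fin 4)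
    (χ : Fin d → Fin d → ℂ) :
    ∑ w, ∑ w', normSq (overlapTwo phaseVec (x, y, w) (x', y', w') χ)
      = 1 / (4 * (4 ^ d * 4 ^ d) ^ 2) * (normSq (phaseDotTwo x x' χ) + normSq (phaseDotTwo y x' χ)
        + normSq (phaseDotTwo x y' χ) + normSq (phaseDotTwo y y' χ)) := by
  simp only [overlapTwo_phaseVec, normSq_mul, ← Finset.mul_sum, sum_normSq_add_phase_mul,
    Finset.sum_add_distrib, normSq_ofReal, phaseNorm_mul_self]
  field_simp
  ring

/-- The coefficients of a two-particle operator with respect to the products of the projections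
on the vectors `phaseVec`. -/
noncomputable def phaseCoeff {d : ℕ} (K : Fin d → Fin d → Fin d → Fin d → ℂ)
    (o o' : PhaseOutcome d) : ℂ :=
  4 * phase o.2.2 * phase o'.2.2 * phaseElement K o.1 o'.1 o.2.1 o'.2.1

theorem sum_phaseCoeff_mul {d : ℕ} (K : Fin d → Fin d → Fin d → Fin d → ℂ) (a b a' b' : Fin d) :
    ∑ o, ∑ o', phaseCoeff K o o' * ((phaseVec o a * conj (phaseVec o a')) *
      (phaseVec o' b * conj (phaseVec o' b'))) = K a b a' b' := by
  calc _ = ∑ o : PhaseOutcome d, ∑ o' : PhaseOutcome d, ∑ p : Fin d × Fin d, ∑ q : Fin d × Fin d,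
        K p.1 p.2 q.1 q.2 *
        (2 * phase o.2.2 * (conj (phase (o.1 p.1)) * phase (o.2.1 q.1)) *
          (phaseVec o a * conj (phaseVec o a'))) *
        (2 * phase o'.2.2 * (conj (phase (o'.1 p.2)) * phase (o'.2.1 q.2)) *
          (phaseVec o' b * conj (phaseVec o' b'))) := by
        refine Finset.sum_congr rfl fun o _ => Finset.sum_congr rfl fun o' _ => ?_
        simp only [phaseCoeff, phaseElement_eq, Finset.mul_sum, Finset.sum_mul]
        exact Finset.sum_congr rfl fun _ _ => Finset.sum_congr rfl fun _ _ => by ring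
    _ = ∑ p : Fin d × Fin d, ∑ q : Fin d × Fin d, K p.1 p.2 q.1 q.2 *
        (if p.1 = a ∧ q.1 = a' then 1 else 0) * (if p.2 = b ∧ q.2 = b' then 1 else 0) := by
        simp only [← sum_dual_phaseVec, Finset.mul_sum, Finset.sum_mul]
        rw [sum_comm_pairs]
        refine Finset.sum_congr rfl fun _ _ => Finset.sum_congr rfl fun _ _ => ?_
        exact Finset.sum_comm
    _ = _ := by
        rw [Finset.sum_eq_single (a, b), Finset.sum_eq_single (a', b')]
        · simp
        · rintro ⟨s, t⟩ _ hne
          have : ¬ (s = a' ∧ t = b') := fun h => hne (Prod.ext h.1 h.2)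
          simp
          tauto
        · simp
        · rintro ⟨s, t⟩ _ hne
          refine Finset.sum_eq_zero fun q _ => ?_
          have : ¬ (s = a ∧ t = b) := fun h => hne (Prod.ext h.1 h.2)
          simp
          tauto
        · simp

theorem sum_normSq_phaseCoeff_mul {d : ℕ} (K : Fin d → Fin d → Fin d → Fin d → ℂ)
    (χ : Fin d → Fin d → ℂ) :
    ∑ o, ∑ o', normSq (phaseCoeff K o o') * normSq (overlapTwo phaseVec o o' χ)
      = 4 / (4 ^ d * 4 ^ d) ^ 2 * (
      (∑ x, ∑ x', ∑ y, ∑ y', normSq (phaseElement K x x' y y') * normSq (phaseDotTwo x x' χ))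
      + (∑ x, ∑ x', ∑ y, ∑ y', normSq (phaseElement K x x' y y') * normSq (phaseDotTwo y x' χ))
      + (∑ x, ∑ x', ∑ y, ∑ y', normSq (phaseElement K x x' y y') * normSq (phaseDotTwo x y' χ))
      + (∑ x, ∑ x', ∑ y, ∑ y', normSq (phaseElement K x x' y y') * normSq (phaseDotTwo y y' χ))) := by
  have h1 : ∀ (x y x' y' : Fin d → Fin 4), ∑ w, ∑ w', normSq (4 * phase w * phase w' *
      phaseElement K x x' y y') * normSq (overlapTwo phaseVec (x, y, w) (x', y', w') χ)
      = 4 / (4 ^ d * 4 ^ d) ^ 2 * (normSq (phaseElement K x x' y y') *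
        (normSq (phaseDotTwo x x' χ) + normSq (phaseDotTwo y x' χ)
        + normSq (phaseDotTwo x y' χ) + normSq (phaseDotTwo y y' χ))) := by
    intro x y x' y'
    have : normSq 4 = 16 := by norm_num [normSq_apply]
    simp only [normSq_mul, normSq_phase, this, ← Finset.mul_sum, sum_normSq_overlapTwo_phaseVec]
    ring
  calc _ = ∑ x, ∑ y, ∑ x', ∑ y', ∑ w, ∑ w', normSq (4 * phase w * phase w' *
      phaseElement K x x' y y') * normSq (overlapTwo phaseVec (x, y, w) (x', y', w') χ) := by
        simp only [phaseCoeff, Fintype.sum_prod_type]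
        refine Finset.sum_congr rfl fun _ _ => Finset.sum_congr rfl fun _ _ => ?_
        rw [Finset.sum_comm]
        exact Finset.sum_congr rfl fun _ _ => Finset.sum_comm
    _ = ∑ x, ∑ x', ∑ y, ∑ y', 4 / (4 ^ d * 4 ^ d) ^ 2 * (normSq (phaseElement K x x' y y') *
        (normSq (phaseDotTwo x x' χ) + normSq (phaseDotTwo y x' χ)
        + normSq (phaseDotTwo x y' χ) + normSq (phaseDotTwo y y' χ))) := by
        simp only [h1]
        exact Finset.sum_congr rfl fun _ _ => Finset.sum_comm
    _ = 4 / (4 ^ d * 4 ^ d) ^ 2 * (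
        (∑ x, ∑ x', ∑ y, ∑ y', normSq (phaseElement K x x' y y') * normSq (phaseDotTwo x x' χ))
        + (∑ x, ∑ x', ∑ y, ∑ y', normSq (phaseElement K x x' y y') * normSq (phaseDotTwo y x' χ))
        + (∑ x, ∑ x', ∑ y, ∑ y', normSq (phaseElement K x x' y y') * normSq (phaseDotTwo x y' χ))
        + (∑ x, ∑ x', ∑ y, ∑ y', normSq (phaseElement K x x' y y')
          * normSq (phaseDotTwo y y' χ))) := by
        simp only [mul_add, Finset.sum_add_distrib, Finset.mul_sum]

/-- Averaging over the relative phases leaves two one-sided and two mixed weights, and the constant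
is `4 * (1 + 1 + 2 + 2)`. Bounding the coefficients pointwise would give order `d ^ 4` instead of `d
^ 2`. -/
theorem sum_normSq_phaseCoeff_mul_le {d : ℕ} {K : Fin d → Fin d → Fin d → Fin d → ℂ}
    (hK : ∀ a b a' b', conj (K a b a' b') = K a' b' a b)
    (hK1 : ∀ χ, ∑ a, ∑ b, normSq (applyTwo K χ a b) ≤ ∑ a, ∑ b, normSq (χ a b))
    (χ : Fin d → Fin d → ℂ) :
    ∑ o, ∑ o', normSq (phaseCoeff K o o') * normSq (overlapTwo phaseVec o o' χ)
      ≤ 24 * (d : ℝ) ^ 2 * ∑ a, ∑ b, normSq (χ a b) := by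
  have hB := sum_normSq_phaseElement_mul_le_left hK hK1 χ
  have hM := sum_normSq_phaseElement_mul_le_mixed hK1 χ
  have hB' : ∑ x, ∑ x', ∑ y, ∑ y', normSq (phaseElement K x x' y y') *
      normSq (phaseDotTwo y y' χ) = ∑ x, ∑ x', ∑ y, ∑ y',
      normSq (phaseElement K x x' y y') * normSq (phaseDotTwo x x' χ) := by
    rw [sum_comm_pairs]
    exact Finset.sum_congr rfl fun _ _ => Finset.sum_congr rfl fun _ _ =>
      Finset.sum_congr rfl fun _ _ => Finset.sum_congr rfl fun _ _ => by
        rw [normSq_phaseElement_comm hK]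
  have hM' : ∑ x, ∑ x', ∑ y, ∑ y', normSq (phaseElement K x x' y y') *
      normSq (phaseDotTwo y x' χ) = ∑ x, ∑ x', ∑ y, ∑ y',
      normSq (phaseElement K x x' y y') * normSq (phaseDotTwo x y' χ) := by
    rw [sum_comm_pairs]
    exact Finset.sum_congr rfl fun _ _ => Finset.sum_congr rfl fun _ _ =>
      Finset.sum_congr rfl fun _ _ => Finset.sum_congr rfl fun _ _ => by
        rw [normSq_phaseElement_comm hK]
  have hM2 : ∑ x, ∑ x', ∑ y, ∑ y', normSq (phaseElement K x x' y y') *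
      normSq (phaseDotTwo x y' χ) = ∑ y', ∑ x, ∑ y, ∑ x',
      normSq (phaseElement K x x' y y') * normSq (phaseDotTwo x y' χ) := by
    rw [Finset.sum_comm (γ := Fin d → Fin 4) (f := fun y' x => ∑ y, ∑ x', normSq
      (phaseElement K x x' y y') * normSq (phaseDotTwo x y' χ))]
    refine Finset.sum_congr rfl fun x _ => ?_
    rw [Finset.sum_comm, Finset.sum_congr rfl fun y _ => Finset.sum_comm, Finset.sum_comm]
  rw [hM2] at hM'
  rw [sum_normSq_phaseCoeff_mul, hB', hM', hM2]
  calc _ ≤ 4 / (4 ^ d * 4 ^ d) ^ 2 * (6 * (4 ^ d * 4 ^ d * (d : ℝ) ^ 2 *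
          (4 ^ d * 4 ^ d * ∑ a, ∑ b, normSq (χ a b)))) :=
        mul_le_mul_of_nonneg_left (by linarith) (by positivity)
    _ = _ := by
      generalize ∑ a, ∑ b, normSq (χ a b) = S
      have : (4 : ℝ) ^ d ≠ 0 := by positivity
      generalize (4 : ℝ) ^ d = N at this ⊢
      field_simp
      ring

end

/-! ### Entropy, conditional mutual information and the Hellinger distance -/

section

open Finset

section Information

variable {X A B Z : Type*} [Fintype X]

open Classical in
/-- The probability that `f = y` under the weights `P`. -/
noncomputable def prob (P : X → ℝ) (f : X → A) (y : A) : ℝ :=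
  ∑ x, if f x = y then P x else 0

/-- The Shannon entropy of `f` under the weights `P`. -/
noncomputable def ent (P : X → ℝ) (f : X → A) : ℝ :=
  -∑ x, P x * Real.log (prob P f (f x))

/-- The conditional mutual information `I(a : b | c)` under the weights `P`. -/
noncomputable def condMutualInfo (P : X → ℝ) (a : X → A) (b : X → B) (c : X → Z) : ℝ :=
  ent P (fun x => (a x, c x)) + ent P (fun x => (b x, c x)) - ent P c
    - ent P (fun x => (a x, b x, c x))

theorem prob_nonneg {P : X → ℝ} (hP : ∀ x, 0 ≤ P x) (f : X → A) (y : A) : 0 ≤ prob P f y :=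
  sum_nonneg fun x _ => by split_ifs <;> simp [hP]

theorem le_prob {P : X → ℝ} (hP : ∀ x, 0 ≤ P x) (f : X → A) (x : X) : P x ≤ prob P f (f x) := by
  classical
  have := single_le_sum (f := fun k => if f k = f x then P k else 0)
    (fun k _ => by split_ifs <;> simp [hP]) (mem_univ x)
  simpa [prob] using this

theorem sum_prob_mul [Fintype A] (P : X → ℝ) (f : X → A) (G : A → ℝ) :
    ∑ y, prob P f y * G y = ∑ x, P x * G (f x) := by
  classical
  simp only [prob, sum_mul]
  rw [sum_comm]
  simp

theorem sum_prob [Fintype A] (P : X → ℝ) (f : X → A) : ∑ y, prob P f y = ∑ x, P x := by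
  simpa using sum_prob_mul P f fun _ => 1

theorem prob_congr (P : X → ℝ) {f : X → A} {g : X → B} {y : A} {z : B}
    (h : ∀ x, f x = y ↔ g x = z) : prob P f y = prob P g z := by
  classical
  unfold prob
  refine sum_congr rfl fun x _ => ?_
  by_cases h1 : f x = y
  · rw [if_pos h1, if_pos ((h x).mp h1)]
  · rw [if_neg h1, if_neg fun h2 => h1 ((h x).mpr h2)]

theorem ent_congr (P : X → ℝ) {f : X → A} {g : X → B}
    (h : ∀ x y, f x = f y ↔ g x = g y) : ent P f = ent P g := by
  unfold ent
  congr 1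
  refine sum_congr rfl fun x _ => ?_
  rw [prob_congr P fun y => h y x]

theorem prob_pos_of_prob_pair_pos {P : X → ℝ} (hP : ∀ x, 0 ≤ P x) {f : X → A} {g : X → B}
    {y : A} {z : B} (hfg : ∀ x, f x = y → g x = z) (h : 0 < prob P f y) : 0 < prob P g z := by
  refine h.trans_le (sum_le_sum fun x _ => ?_)
  by_cases h1 : f x = y
  · simp [h1, hfg x h1]
  · simp only [h1, if_false]
    split_ifs <;> simp [hP]

theorem sum_prob_fst [Fintype A] (P : X → ℝ) (a : X → A) (c : X → Z) (z : Z) :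
    ∑ y, prob P (fun x => (a x, c x)) (y, z) = prob P c z := by
  classical
  simp only [prob, Prod.mk.injEq, ite_and]
  rw [sum_comm]
  simp

/-- The joint distribution that `a`, `b` and `c` would have if `a` and `b` were independent
given `c`, with the same marginals. -/
noncomputable def condProd (P : X → ℝ) (a : X → A) (b : X → B) (c : X → Z) (t : A × B × Z) : ℝ :=
  prob P (fun x => (a x, c x)) (t.1, t.2.2) * prob P (fun x => (b x, c x)) (t.2.1, t.2.2)
    / prob P c t.2.2

theorem sum_condProd [Fintype A] [Fintype B] [Fintype Z] (P : X → ℝ) (a : X → A)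
    (b : X → B) (c : X → Z) : ∑ t, condProd P a b c t = ∑ x, P x := by
  rw [← sum_prob P c]
  simp only [condProd, Fintype.sum_prod_type]
  rw [sum_congr rfl fun _ _ => sum_comm, sum_comm]
  refine sum_congr rfl fun z _ => ?_
  simp only [← sum_div, ← mul_sum, sum_prob_fst, ← sum_mul]
  -- This also covers conditions of probability zero, where division by zero returns 0.
  exact mul_self_div_self _

theorem condMutualInfo_eq [Fintype A] [Fintype B] [Fintype Z] {P : X → ℝ} (hP : ∀ x, 0 ≤ P x)
    (a : X → A) (b : X → B) (c : X → Z) :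
    condMutualInfo P a b c = ∑ t, prob P (fun x => (a x, b x, c x)) t *
      Real.log (prob P (fun x => (a x, b x, c x)) t / condProd P a b c t) := by
  rw [sum_prob_mul P (fun x => (a x, b x, c x)) fun t =>
    Real.log (prob P (fun x => (a x, b x, c x)) t / condProd P a b c t)]
  unfold condMutualInfo ent
  rw [← sub_eq_zero]
  have : ∀ x, P x * Real.log (prob P (fun x => (a x, b x, c x)) (a x, b x, c x)
      / condProd P a b c (a x, b x, c x))
      = P x * Real.log (prob P (fun x => (a x, b x, c x)) (a x, b x, c x))
        + P x * Real.log (prob P c (c x)) - P x * Real.log (prob P (fun x => (a x, c x)) (a x, c x))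
        - P x * Real.log (prob P (fun x => (b x, c x)) (b x, c x)) := by
    intro x
    rcases (hP x).eq_or_lt with h0 | h0
    · simp [← h0]
    have h1 := h0.trans_le (le_prob hP (fun x => (a x, b x, c x)) x)
    have h2 := h0.trans_le (le_prob hP (fun x => (a x, c x)) x)
    have h3 := h0.trans_le (le_prob hP (fun x => (b x, c x)) x)
    have h4 := h0.trans_le (le_prob hP c x)
    simp only [condProd]
    rw [div_div_eq_mul_div, Real.log_div (by positivity) (by positivity),
      Real.log_mul (by positivity) (by positivity), Real.log_mul (by positivity) (by positivity)]
    ring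
  simp only [this, sum_sub_distrib, sum_add_distrib]
  ring

/-- The squared Hellinger distance is at most the relative entropy. -/
theorem sum_sqrt_sub_sqrt_sq_le {T : Type*} [Fintype T] {p q : T → ℝ} (hp : ∀ t, 0 ≤ p t)
    (hq : ∀ t, 0 ≤ q t) (hpq : ∀ t, 0 < p t → 0 < q t) (hs : ∑ t, p t = ∑ t, q t) :
    ∑ t, (√(p t) - √(q t)) ^ 2 ≤ ∑ t, p t * Real.log (p t / q t) := by
  have h1 : ∀ t, p t - q t + (√(p t) - √(q t)) ^ 2 ≤ p t * Real.log (p t / q t) := by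
    intro t
    have e1 := Real.mul_self_sqrt (hp t)
    have e2 := Real.mul_self_sqrt (hq t)
    rcases (hp t).eq_or_lt with h0 | h0
    · rw [← h0]
      simp
      nlinarith
    · have h2 := hpq t h0
      -- Applying `log u ≤ u - 1` to the square root of the ratio, not to the ratio itself, is what
      -- produces the square `(√p - √q) ^ 2`.
      have h3 := Real.log_le_sub_one_of_pos (x := √(q t) / √(p t)) (by positivity)
      have h4 : Real.log (p t / q t) = -2 * Real.log (√(q t) / √(p t)) := by
        rw [Real.log_div (by positivity) (by positivity),
          Real.log_div (by positivity) (by positivity), Real.log_sqrt h0.le, Real.log_sqrt h2.le]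
        ring
      rw [h4]
      have h5 : p t * (√(q t) / √(p t)) = √(p t) * √(q t) := by
        have : √(p t) ≠ 0 := by positivity
        nth_rewrite 1 [← e1]
        field_simp
      nlinarith [mul_le_mul_of_nonneg_left h3 h0.le]
  calc _ = ∑ t, (p t - q t + (√(p t) - √(q t)) ^ 2) := by
        rw [sum_add_distrib, sum_sub_distrib, hs, sub_self, zero_add]
    _ ≤ _ := sum_le_sum fun t _ => h1 t

/-- Cauchy-Schwarz after factoring `q - p = (√q - √p) (√q + √p)`. Unlike a total variation bound,
this needs no bound on the maximum of `h`, only its second moments under `p` and `q`. -/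
theorem sum_sub_mul_le_sqrt {T : Type*} [Fintype T] {p q : T → ℝ} (hp : ∀ t, 0 ≤ p t)
    (hq : ∀ t, 0 ≤ q t) (hpq : ∀ t, 0 < p t → 0 < q t) (hs : ∑ t, p t = ∑ t, q t)
    (h : T → ℝ) {S : ℝ} (hpS : ∑ t, p t * h t ^ 2 ≤ S) (hqS : ∑ t, q t * h t ^ 2 ≤ S) :
    ∑ t, q t * h t - ∑ t, p t * h t ≤ √(4 * S * ∑ t, p t * Real.log (p t / q t)) := by
  refine Real.le_sqrt_of_sq_le ?_
  have h1 : ∑ t, q t * h t - ∑ t, p t * h t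
      = ∑ t, (√(q t) - √(p t)) * ((√(q t) + √(p t)) * h t) := by
    rw [← sum_sub_distrib]
    refine sum_congr rfl fun t _ => ?_
    have e1 := Real.mul_self_sqrt (hp t)
    have e2 := Real.mul_self_sqrt (hq t)
    linear_combination h t * (e1 - e2)
  have h2 : ∑ t, ((√(q t) + √(p t)) * h t) ^ 2 ≤ 4 * S := by
    calc _ ≤ ∑ t, (2 * (p t * h t ^ 2) + 2 * (q t * h t ^ 2)) := by
          refine sum_le_sum fun t _ => ?_
          have e1 := Real.sq_sqrt (hp t)
          have e2 := Real.sq_sqrt (hq t)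
          nlinarith [mul_nonneg (sq_nonneg (√(q t) - √(p t))) (sq_nonneg (h t))]
      _ = 2 * ∑ t, p t * h t ^ 2 + 2 * ∑ t, q t * h t ^ 2 := by
          rw [sum_add_distrib, mul_sum, mul_sum]
      _ ≤ _ := by linarith
  have h3 := sum_sqrt_sub_sqrt_sq_le hp hq hpq hs
  have h4 : ∑ t, (√(q t) - √(p t)) ^ 2 = ∑ t, (√(p t) - √(q t)) ^ 2 :=
    sum_congr rfl fun t _ => by ring
  rw [h1, mul_comm (4 * S)]
  refine (sum_mul_sq_le_sq_mul_sq _ _ _).trans ?_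
  rw [h4]
  have h5 : 0 ≤ ∑ t, (√(p t) - √(q t)) ^ 2 := sum_nonneg fun _ _ => sq_nonneg _
  exact mul_le_mul h3 h2 (sum_nonneg fun _ _ => sq_nonneg _) (h5.trans h3)

theorem condProd_nonneg {P : X → ℝ} (hP : ∀ x, 0 ≤ P x) (a : X → A) (b : X → B) (c : X → Z)
    (t : A × B × Z) : 0 ≤ condProd P a b c t :=
  div_nonneg (mul_nonneg (prob_nonneg hP _ _) (prob_nonneg hP _ _)) (prob_nonneg hP _ _)

theorem condProd_pos {P : X → ℝ} (hP : ∀ x, 0 ≤ P x) (a : X → A) (b : X → B) (c : X → Z)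
    (t : A × B × Z) (h : 0 < prob P (fun x => (a x, b x, c x)) t) : 0 < condProd P a b c t := by
  refine div_pos (mul_pos ?_ ?_) ?_ <;>
  · refine prob_pos_of_prob_pair_pos hP (fun x hx => ?_) h
    simp [← hx]

theorem condMutualInfo_nonneg [Fintype A] [Fintype B] [Fintype Z] {P : X → ℝ}
    (hP : ∀ x, 0 ≤ P x) (a : X → A) (b : X → B) (c : X → Z) : 0 ≤ condMutualInfo P a b c := by
  rw [condMutualInfo_eq hP]
  refine le_trans (sum_nonneg fun t _ => sq_nonneg _) (sum_sqrt_sub_sqrt_sq_le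
    (prob_nonneg hP _) (condProd_nonneg hP a b c) (condProd_pos hP a b c) ?_)
  rw [sum_condProd, sum_prob]

theorem sum_condProd_sub_le_sqrt_condMutualInfo [Fintype A] [Fintype B] [Fintype Z] {P : X → ℝ}
    (hP : ∀ x, 0 ≤ P x) (a : X → A) (b : X → B) (c : X → Z) (h : A × B × Z → ℝ) {S : ℝ}
    (hpS : ∑ x, P x * h (a x, b x, c x) ^ 2 ≤ S)
    (hqS : ∑ t, condProd P a b c t * h t ^ 2 ≤ S) :
    ∑ t, condProd P a b c t * h t - ∑ x, P x * h (a x, b x, c x)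
      ≤ √(4 * S * condMutualInfo P a b c) := by
  rw [condMutualInfo_eq hP, ← sum_prob_mul P (fun x => (a x, b x, c x)) h]
  rw [← sum_prob_mul P (fun x => (a x, b x, c x)) fun t => h t ^ 2] at hpS
  refine sum_sub_mul_le_sqrt (prob_nonneg hP _) (condProd_nonneg hP a b c)
    (condProd_pos hP a b c) ?_ h hpS hqS
  rw [sum_condProd, sum_prob]

/-- If the conditional probabilities of the values of `a` given `c` are bounded by weights `μ` of
total mass `d`, then the mutual information of `a` and `c` is at most `log d`. -/
theorem ent_add_ent_sub_ent_le_log [Fintype A] {P : X → ℝ} (hP : ∀ x, 0 ≤ P x)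
    (hP1 : ∑ x, P x = 1) (a : X → A) (c : X → Z) (μ : A → ℝ) {d : ℝ} (hd : 0 < d)
    (hμ0 : ∀ y, 0 ≤ μ y) (hμ : ∑ y, μ y = d)
    (h : ∀ y z, prob P (fun x => (a x, c x)) (y, z) ≤ μ y * prob P c z) :
    ent P a + ent P c - ent P (fun x => (a x, c x)) ≤ Real.log d := by
  have h1 : ∀ x, P x * Real.log (prob P (fun x => (a x, c x)) (a x, c x))
      - P x * Real.log (prob P a (a x)) - P x * Real.log (prob P c (c x))
      ≤ P x * (Real.log d - 1) + P x * (μ (a x) / (d * prob P a (a x))) := by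
    intro x
    rcases (hP x).eq_or_lt with h0 | h0
    · simp [← h0]
    have h2 := h0.trans_le (le_prob hP (fun x => (a x, c x)) x)
    have h3 := h0.trans_le (le_prob hP a x)
    have h4 := h0.trans_le (le_prob hP c x)
    have h5 : 0 < μ (a x) := pos_of_mul_pos_left (h2.trans_le (h _ _)) h4.le
    have h6 := Real.log_le_log h2 (h (a x) (c x))
    rw [Real.log_mul h5.ne' h4.ne'] at h6
    -- Gibbs' inequality for the law of `a` against the probability weights `μ / d`.
    have h7 := Real.log_le_sub_one_of_pos (x := μ (a x) / (d * prob P a (a x))) (by positivity)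
    rw [Real.log_div h5.ne' (by positivity), Real.log_mul hd.ne' h3.ne'] at h7
    nlinarith
  have h2 : ∑ x, P x * (μ (a x) / (d * prob P a (a x))) ≤ 1 := by
    rw [← sum_prob_mul P a fun y => μ y / (d * prob P a y)]
    calc _ ≤ ∑ y, μ y / d := by
          refine sum_le_sum fun y _ => ?_
          rcases (prob_nonneg hP a y).eq_or_lt with h0 | h0
          · rw [← h0]
            simpa using div_nonneg (hμ0 y) hd.le
          · refine le_of_eq ?_
            field_simp
      _ = 1 := by rw [← sum_div, hμ, div_self hd.ne']
  have h3 := sum_le_sum fun x (_ : x ∈ univ) => h1 x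
  simp only [sum_sub_distrib, sum_add_distrib, ← sum_mul, hP1] at h3
  unfold ent
  linarith

end Information

end

/-! ### Sums over configurations -/

section

open Finset Complex ComplexConjugate

section Sites

variable {V Ω : Type*} [Fintype V] [DecidableEq V] [Fintype Ω] [DecidableEq Ω]

/-- Indicator factors pin the values at `i` and `j`, so that the sum becomes a product over sites.
It is applied to measurement outcomes and also, with whole configurations as values, to the
independent draws behind `mixAvg`. -/
theorem sum_two_site {R : Type*} [CommSemiring R] {i j : V} (hij : i ≠ j) (f : Ω → Ω → R)
    (g : V → Ω → R) : ∑ x : V → Ω, f (x i) (x j) * ∏ v, g v (x v)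
      = (∑ o, ∑ o', f o o' * (g i o * g j o')) * ∏ v ∈ (univ.erase i).erase j, ∑ o, g v o := by
  have hj : j ∈ univ.erase i := by simp [hij.symm]
  have h1 : ∀ p p' : Ω, ∑ x : V → Ω, (if x i = p then 1 else 0) * (if x j = p' then 1 else 0)
      * ∏ v, g v (x v) = (g i p * g j p') * ∏ v ∈ (univ.erase i).erase j, ∑ o, g v o := by
    intro p p'
    let w : V → Ω → R := fun v o =>
      if v = i then if o = p then 1 else 0 else if v = j then if o = p' then 1 else 0 else 1
    have hw : ∀ v ∈ (univ.erase i).erase j, ∀ o, w v o = 1 := by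
      intro v hv o
      simp only [mem_erase] at hv
      simp [w, hv.1, hv.2.1]
    have h2 : ∀ x : V → Ω, ∏ v, w v (x v) = (if x i = p then 1 else 0)
        * (if x j = p' then 1 else 0) := by
      intro x
      rw [← mul_prod_erase univ _ (mem_univ i), ← mul_prod_erase _ _ hj,
        prod_congr rfl fun v hv => hw v hv _]
      simp [w, hij.symm]
    simp only [← h2, ← prod_mul_distrib]
    rw [← Fintype.piFinset_univ, ← prod_univ_sum (fun _ => univ) fun v o => w v o * g v o,
      ← mul_prod_erase univ _ (mem_univ i), ← mul_prod_erase _ _ hj,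
      prod_congr rfl fun v hv => sum_congr rfl fun o _ => by rw [hw v hv o, one_mul], ← mul_assoc]
    simp [w, hij.symm]
  calc _ = ∑ x : V → Ω, ∑ p, ∑ p', f p p' * ((if x i = p then 1 else 0)
      * (if x j = p' then 1 else 0) * ∏ v, g v (x v)) :=
        sum_congr rfl fun x _ => by simp
    _ = ∑ p, ∑ p', f p p' * ((g i p * g j p') * ∏ v ∈ (univ.erase i).erase j, ∑ o, g v o) := by
        rw [sum_comm]
        refine sum_congr rfl fun p _ => ?_
        rw [sum_comm]
        exact sum_congr rfl fun p' _ => by rw [← mul_sum, h1]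
    _ = _ := by simp only [sum_mul, mul_assoc]

omit [DecidableEq Ω] in
theorem sum_prod_eq_prod_sum {R : Type*} [CommSemiring R] (g : V → Ω → R) :
    ∑ x : V → Ω, ∏ v, g v (x v) = ∏ v, ∑ o, g v o := by
  rw [prod_univ_sum, Fintype.piFinset_univ]

/-- Summing over all values at a site before summing over everything counts everything as often
as there are values. -/
theorem sum_sum_update {R : Type*} [CommSemiring R] (F : (V → Ω) → R) (i : V) :
    ∑ x, ∑ o, F (Function.update x i o) = Fintype.card Ω * ∑ x, F x := by
  have h : ∀ x : V → Ω, ∀ o, F (Function.update x i o)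
      = ∑ y, if (∀ v, v ≠ i → x v = y v) ∧ y i = o then F y else 0 := by
    intro x o
    rw [sum_eq_single (Function.update x i o)]
    · rw [if_pos]
      refine ⟨fun v hv => by simp [hv], by simp⟩
    · intro y _ hy
      rw [if_neg]
      rintro ⟨h1, h2⟩
      refine hy (funext fun v => ?_)
      by_cases hv : v = i
      · subst hv; simp [h2]
      · simp [hv, h1 v hv]
    · simp
  have h2 : ∀ y : V → Ω, ∑ x : V → Ω, (if ∀ v, v ≠ i → x v = y v then (1 : R) else 0)
      = Fintype.card Ω := by
    intro y
    have h3 : ∀ x : V → Ω, (if ∀ v, v ≠ i → x v = y v then (1 : R) else 0)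
        = ∏ v, if v = i then 1 else if x v = y v then 1 else 0 := by
      intro x
      split_ifs with hx
      · exact (prod_eq_one fun v _ => by by_cases hv : v = i <;> simp [hv, hx v]).symm
      · push Not at hx
        obtain ⟨v, hv, hxv⟩ := hx
        exact (prod_eq_zero (mem_univ v) (by simp [hv, hxv])).symm
    simp only [h3]
    rw [sum_prod_eq_prod_sum fun v o => if v = i then 1 else if o = y v then 1 else 0,
      prod_eq_single i]
    · simp
    · intro v _ hv
      simp [hv]
    · simp
  simp only [h]
  rw [sum_congr rfl fun x _ => sum_comm, sum_comm, mul_sum]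
  refine sum_congr rfl fun y _ => ?_
  rw [← h2 y, sum_mul]
  refine sum_congr rfl fun x _ => ?_
  simp [ite_and]

end Sites

/-! ### Outcome amplitudes and the energy as a classical mean -/

section Amplitudes

variable {V Ω : Type*} [Fintype V] [DecidableEq V] [Fintype Ω] [DecidableEq Ω] {d : ℕ}

theorem sum_conj_mul_mul_eq_trace (H : QuditOp V d) (ψ : QuditSpace V d) :
    (H * pureDensity ψ).trace = ∑ y, ∑ y', conj (ψ y) * H y y' * ψ y' := by
  simp only [Matrix.trace, Matrix.diag_apply, Matrix.mul_apply, pureDensity, Matrix.of_apply]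
  exact sum_congr rfl fun _ _ => sum_congr rfl fun _ _ => by
    rw [← starRingEnd_apply]
    ring

theorem expectation_eq (H : QuditOp V d) (ψ : QuditSpace V d) :
    expectation H ψ = (∑ y, ∑ y', conj (ψ y) * H y y' * ψ y').re := by
  unfold expectation
  congr 1
  rw [PiLp.inner_apply]
  refine sum_congr rfl fun y _ => ?_
  rw [RCLike.inner_apply, Matrix.ofLp_toEuclideanCLM, Matrix.mulVec, dotProduct, sum_mul]
  exact sum_congr rfl fun _ _ => by ring

/-- The amplitude of `ψ` on the product of the vectors `m (x v)`. -/
def amp (m : Ω → Fin d → ℂ) (ψ : QuditSpace V d) (x : V → Ω) : ℂ :=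
  ∑ y : V → Fin d, (∏ v, conj (m (x v) (y v))) * ψ y

/-- The inner product of `m o` with `φ`. -/
def overlap (m : Ω → Fin d → ℂ) (o : Ω) (φ : Fin d → ℂ) : ℂ :=
  ∑ a, conj (m o a) * φ a

omit [Fintype Ω] [DecidableEq Ω] in
theorem amp_productVector (m : Ω → Fin d → ℂ) (φ : V → EuclideanSpace ℂ (Fin d)) (x : V → Ω) :
    amp m (productVector φ) x = ∏ v, overlap m (x v) (φ v) := by
  simp only [amp, productVector, overlap, ← prod_mul_distrib]
  exact sum_prod_eq_prod_sum fun v a => conj (m (x v) a) * φ v a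

omit [DecidableEq Ω] in
theorem sum_mul_normSq_amp (m : Ω → Fin d → ℂ) (ψ : QuditSpace V d) (F : (V → Ω) → ℂ) :
    ∑ x, F x * normSq (amp m ψ x) = ∑ y, ∑ y', conj (ψ y) *
      (∑ x, F x * ∏ v, (m (x v) (y v) * conj (m (x v) (y' v)))) * ψ y' := by
  simp only [mul_sum, sum_mul]
  rw [sum_comm_cycle]
  refine sum_congr rfl fun x _ => ?_
  rw [normSq_eq_conj_mul_self, amp, map_sum, sum_mul_sum, mul_sum]
  refine sum_congr rfl fun y _ => ?_
  rw [mul_sum]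
  refine sum_congr rfl fun y' _ => ?_
  simp only [map_mul, map_prod, conj_conj, prod_mul_distrib]
  ring

/-- `h` gives the coefficients of the two-particle operator `A` on the particles `i` and `j`
with respect to the products of the projections on the vectors `m o`. -/
def IsDual (m : Ω → Fin d → ℂ) (A : QuditOp V d) (i j : V) (h : Ω → Ω → ℂ) : Prop :=
  ∀ y y' : V → Fin d, A y y' = if ∀ v, v ≠ i → v ≠ j → y v = y' v then
    ∑ o, ∑ o', h o o' * ((m o (y i) * conj (m o (y' i))) * (m o' (y j) * conj (m o' (y' j)))) else 0

/-- At the sites other than `i` and `j` the projections sum to the identity by `hm`, which is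
exactly how `A` acts there. -/
theorem expectation_eq_of_isDual {m : Ω → Fin d → ℂ}
    (hm : ∀ a b, ∑ o, m o a * conj (m o b) = if a = b then 1 else 0) {A : QuditOp V d} {i j : V}
    (hij : i ≠ j) {h : Ω → Ω → ℂ} (hA : IsDual m A i j h) (ψ : QuditSpace V d) :
    expectation A ψ = ∑ x : V → Ω, (h (x i) (x j)).re * normSq (amp m ψ x) := by
  rw [expectation_eq]
  have := sum_mul_normSq_amp m ψ fun x => h (x i) (x j)
  have h2 : ∀ y y' : V → Fin d, ∑ x : V → Ω, h (x i) (x j) *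
      ∏ v, (m (x v) (y v) * conj (m (x v) (y' v))) = A y y' := by
    intro y y'
    rw [sum_two_site hij h fun v o => m o (y v) * conj (m o (y' v)), hA]
    simp only [hm]
    split_ifs with hy
    · rw [prod_eq_one, mul_one]
      intro v hv
      simp only [mem_erase] at hv
      rw [if_pos (hy v hv.2.1 hv.1)]
    · push Not at hy
      obtain ⟨v, hi, hj, hv⟩ := hy
      rw [prod_eq_zero (i := v) (by simp [hi, hj]) (by simp [hv]), mul_zero]
  simp only [h2] at this
  rw [← this]
  simp

omit [DecidableEq Ω] in
theorem sum_normSq_amp {m : Ω → Fin d → ℂ}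
    (hm : ∀ a b, ∑ o, m o a * conj (m o b) = if a = b then 1 else 0) (ψ : QuditSpace V d) :
    ∑ x : V → Ω, normSq (amp m ψ x) = ‖ψ‖ ^ 2 := by
  rw [EuclideanSpace.norm_sq_eq]
  apply ofReal_injective
  have := sum_mul_normSq_amp m ψ fun _ => 1
  have h2 : ∀ y y' : V → Fin d, ∑ x : V → Ω,
      ∏ v, (m (x v) (y v) * conj (m (x v) (y' v))) = if y = y' then 1 else 0 := by
    intro y y'
    rw [sum_prod_eq_prod_sum fun v o => m o (y v) * conj (m o (y' v))]
    simp only [hm]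
    split_ifs with hy
    · simp [hy]
    · obtain ⟨v, hv⟩ := Function.ne_iff.mp hy
      exact prod_eq_zero (mem_univ v) (by simp [hv])
  simp only [one_mul, h2] at this
  push_cast
  rw [this]
  refine sum_congr rfl fun y _ => ?_
  simp [conj_mul']

omit [DecidableEq Ω] in
theorem sum_normSq_overlap {m : Ω → Fin d → ℂ}
    (hm : ∀ a b, ∑ o, m o a * conj (m o b) = if a = b then 1 else 0) (φ : Fin d → ℂ) :
    ∑ o, normSq (overlap m o φ) = ∑ a, normSq (φ a) := by
  have := sum_normSq_of_orthogonal (fun o a => conj (m o a)) 1 (fun a b => ?_) φ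
  · simpa [overlap] using this
  · have := hm b a
    simp only [eq_comm (a := b)] at this
    simpa [mul_comm] using this

omit [DecidableEq Ω] in
theorem sum_normSq_overlapTwo {m : Ω → Fin d → ℂ}
    (hm : ∀ a b, ∑ o, m o a * conj (m o b) = if a = b then 1 else 0) (χ : Fin d → Fin d → ℂ) :
    ∑ o, ∑ o', normSq (overlapTwo m o o' χ) = ∑ a, ∑ b, normSq (χ a b) := by
  have h1 : ∀ o o', overlapTwo m o o' χ = overlap m o fun a => overlap m o' (χ a) := by
    intro o o'
    simp only [overlapTwo, overlap, mul_sum, mul_assoc]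
  simp only [h1]
  rw [sum_comm]
  simp only [sum_normSq_overlap hm]
  rw [sum_comm]
  simp only [sum_normSq_overlap hm]

/-- The unnormalised state of particle `i` after the other particles were found in the
states `m (x v)`. -/
def partialAmp (m : Ω → Fin d → ℂ) (ψ : QuditSpace V d) (x : V → Ω) (i : V) (a : Fin d) : ℂ :=
  ∑ y : V → Fin d, if y i = a then (∏ v ∈ univ.erase i, conj (m (x v) (y v))) * ψ y else 0

/-- The unnormalised state of the particles `i` and `j` after the other particles were found in
the states `m (x v)`. -/
def partialAmpTwo (m : Ω → Fin d → ℂ) (ψ : QuditSpace V d) (x : V → Ω) (i j : V) (a b : Fin d) : ℂ :=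
  ∑ y : V → Fin d, if y i = a ∧ y j = b then
    (∏ v ∈ (univ.erase i).erase j, conj (m (x v) (y v))) * ψ y else 0

omit [Fintype Ω] [DecidableEq Ω] in
theorem partialAmp_update (m : Ω → Fin d → ℂ) (ψ : QuditSpace V d) (x : V → Ω) (i : V) (o : Ω) :
    partialAmp m ψ (Function.update x i o) i = partialAmp m ψ x i := by
  ext a
  unfold partialAmp
  refine sum_congr rfl fun y _ => ?_
  congr 2
  refine prod_congr rfl fun v hv => ?_
  rw [Function.update_of_ne (ne_of_mem_erase hv)]

omit [Fintype Ω] [DecidableEq Ω] in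
theorem amp_update (m : Ω → Fin d → ℂ) (ψ : QuditSpace V d) (x : V → Ω) (i : V) (o : Ω) :
    amp m ψ (Function.update x i o) = overlap m o (partialAmp m ψ x i) := by
  rw [← partialAmp_update m ψ x i o]
  simp only [overlap, partialAmp, mul_sum, amp]
  rw [sum_comm]
  refine sum_congr rfl fun y _ => ?_
  simp only [mul_ite, mul_zero, sum_ite_eq, mem_univ, if_true]
  rw [← mul_prod_erase univ _ (mem_univ i), Function.update_self, mul_assoc]

omit [Fintype Ω] [DecidableEq Ω] in
theorem amp_update_update (m : Ω → Fin d → ℂ) (ψ : QuditSpace V d) (x : V → Ω) {i j : V}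
    (hij : i ≠ j) (o o' : Ω) : amp m ψ (Function.update (Function.update x j o') i o)
      = overlapTwo m o o' (partialAmpTwo m ψ x i j) := by
  have hj : j ∈ univ.erase i := by simp [hij.symm]
  simp only [overlapTwo, partialAmpTwo, mul_sum, amp]
  rw [sum_comm_cycle]
  refine sum_congr rfl fun y _ => ?_
  rw [sum_eq_single (y i) (fun a _ ha => sum_eq_zero fun b _ => by simp [ha.symm]) (by simp),
    sum_eq_single (y j) (fun b _ hb => by simp [hb.symm]) (by simp), if_pos ⟨rfl, rfl⟩]
  rw [← mul_prod_erase univ _ (mem_univ i), ← mul_prod_erase _ _ hj, Function.update_self,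
    Function.update_of_ne hij.symm, Function.update_self]
  simp only [mul_assoc]
  congr 3
  refine prod_congr rfl fun v hv => ?_
  simp only [mem_erase] at hv
  rw [Function.update_of_ne hv.2.1, Function.update_of_ne hv.1]

end Amplitudes

end

/-! ### The random product state built from the measurement -/

section

open Finset Complex ComplexConjugate

section Mixture

variable {V Ω : Type*} [Fintype V] [DecidableEq V] [Fintype Ω] [DecidableEq Ω] {d : ℕ}

/-- The probability of the outcomes `x` in the measurement of all particles. -/
def outcomeProb (m : Ω → Fin d → ℂ) (ψ : QuditSpace V d) (x : V → Ω) : ℝ :=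
  normSq (amp m ψ x)

omit [Fintype Ω] [DecidableEq Ω] in
theorem outcomeProb_nonneg (m : Ω → Fin d → ℂ) (ψ : QuditSpace V d) (x : V → Ω) :
    0 ≤ outcomeProb m ψ x :=
  normSq_nonneg _

/-- The outcomes at the sites in `C`. -/
def outcomesOn (C : Finset V) (x : V → Ω) (v : C) : Ω := x v

omit [Fintype V] [Fintype Ω] [DecidableEq Ω] in
theorem outcomesOn_update {C : Finset V} {i : V} (hi : i ∉ C) (x : V → Ω) (o : Ω) :
    outcomesOn C (Function.update x i o) = outcomesOn C x := by
  ext v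
  exact Function.update_of_ne (ne_of_mem_of_not_mem v.2 hi) _ _

theorem card_mul_prob_outcome (m : Ω → Fin d → ℂ) (ψ : QuditSpace V d) {C : Finset V} {i : V}
    (hi : i ∉ C) (o : Ω) (z : C → Ω) :
    Fintype.card Ω * prob (outcomeProb m ψ) (fun x => (x i, outcomesOn C x)) (o, z)
      = ∑ x : V → Ω, if outcomesOn C x = z then normSq (overlap m o (partialAmp m ψ x i))
        else 0 := by
  unfold prob
  rw [← sum_sum_update _ i]
  refine sum_congr rfl fun x _ => ?_
  simp only [Function.update_self, outcomesOn_update hi, Prod.mk.injEq, ite_and, outcomeProb,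
    amp_update]
  simp

theorem card_mul_prob_outcomesOn {m : Ω → Fin d → ℂ}
    (hm : ∀ a b, ∑ o, m o a * conj (m o b) = if a = b then 1 else 0) (ψ : QuditSpace V d)
    {C : Finset V} {i : V} (hi : i ∉ C) (z : C → Ω) :
    Fintype.card Ω * prob (outcomeProb m ψ) (outcomesOn C) z
      = ∑ x : V → Ω, if outcomesOn C x = z then ∑ a, normSq (partialAmp m ψ x i a) else 0 := by
  rw [← sum_prob_fst (outcomeProb m ψ) (fun x : V → Ω => x i), mul_sum]
  simp only [card_mul_prob_outcome m ψ hi]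
  rw [sum_comm]
  refine sum_congr rfl fun x _ => ?_
  split_ifs
  · exact sum_normSq_overlap hm _
  · simp

omit [Fintype Ω] [DecidableEq Ω] in
theorem normSq_overlap_le (m : Ω → Fin d → ℂ) (o : Ω) (φ : Fin d → ℂ) :
    normSq (overlap m o φ) ≤ (∑ a, normSq (m o a)) * ∑ a, normSq (φ a) := by
  have h1 : ‖overlap m o φ‖ ≤ ∑ a, ‖m o a‖ * ‖φ a‖ :=
    (norm_sum_le _ _).trans (le_of_eq (by simp))
  simp only [normSq_eq_norm_sq]
  exact (pow_le_pow_left₀ (norm_nonneg _) h1 2).trans (sum_mul_sq_le_sq_mul_sq _ _ _)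

/-- For a rank-one measurement, Cauchy-Schwarz bounds the chance of `o` in any state by the squared
norm of `m o`. These weights have total mass `d`, so a site carries at most `log d` of information.
-/
theorem prob_outcome_le [Nonempty Ω] {m : Ω → Fin d → ℂ}
    (hm : ∀ a b, ∑ o, m o a * conj (m o b) = if a = b then 1 else 0) (ψ : QuditSpace V d)
    {C : Finset V} {i : V} (hi : i ∉ C) (o : Ω) (z : C → Ω) :
    prob (outcomeProb m ψ) (fun x => (x i, outcomesOn C x)) (o, z)
      ≤ (∑ a, normSq (m o a)) * prob (outcomeProb m ψ) (outcomesOn C) z := by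
  have hc : (0 : ℝ) < Fintype.card Ω := by exact_mod_cast Fintype.card_pos
  refine le_of_mul_le_mul_left ?_ hc
  rw [card_mul_prob_outcome m ψ hi, mul_left_comm, card_mul_prob_outcomesOn hm ψ hi, mul_sum]
  refine sum_le_sum fun x _ => ?_
  split_ifs
  · exact normSq_overlap_le m o _
  · simp

omit [DecidableEq Ω] in
theorem sum_sum_normSq {m : Ω → Fin d → ℂ}
    (hm : ∀ a b, ∑ o, m o a * conj (m o b) = if a = b then 1 else 0) :
    ∑ o, ∑ a, normSq (m o a) = d := by
  rw [sum_comm]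
  have : ∀ a, ∑ o, normSq (m o a) = 1 := by
    intro a
    apply ofReal_injective
    push_cast
    simp only [← mul_conj]
    rw [hm, if_pos rfl]
  simp [this]

/-- With the outcomes elsewhere fixed, the amplitude is the overlap with a two-particle vector, so
`hg` applies fibre by fibre. Fibres are reached by resampling `i` and `j`, which counts every
configuration `(card Ω) ^ 2` times on both sides. -/
theorem sum_outcomeProb_mul_le [Nonempty Ω] {m : Ω → Fin d → ℂ}
    (hm : ∀ a b, ∑ o, m o a * conj (m o b) = if a = b then 1 else 0) (ψ : QuditSpace V d)
    {i j : V} (hij : i ≠ j) (g : Ω → Ω → ℝ) (S : ℝ)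
    (hg : ∀ χ, ∑ o, ∑ o', g o o' * normSq (overlapTwo m o o' χ)
      ≤ S * ∑ a, ∑ b, normSq (χ a b)) :
    ∑ x : V → Ω, outcomeProb m ψ x * g (x i) (x j) ≤ S * ∑ x : V → Ω, outcomeProb m ψ x := by
  have hc : (0 : ℝ) < Fintype.card Ω := by exact_mod_cast Fintype.card_pos
  have h1 : ∀ F : (V → Ω) → ℝ, ∑ x, ∑ o, ∑ o', F (Function.update (Function.update x j o') i o)
      = Fintype.card Ω * (Fintype.card Ω * ∑ x, F x) := by
    intro F
    rw [← sum_sum_update F i, ← sum_sum_update _ j]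
    exact sum_congr rfl fun x _ => sum_comm
  refine le_of_mul_le_mul_left (le_of_mul_le_mul_left ?_ hc) hc
  rw [mul_left_comm _ S, mul_left_comm _ S, ← h1, ← h1, mul_sum]
  refine sum_le_sum fun x _ => ?_
  simp only [outcomeProb, amp_update_update m ψ x hij, sum_normSq_overlapTwo hm,
    Function.update_self, Function.update_of_ne hij.symm]
  refine le_trans (le_of_eq ?_) (hg _)
  exact sum_congr rfl fun _ _ => sum_congr rfl fun _ _ => mul_comm _ _

theorem exists_unit_vector (hd : 0 < d) (φ : Fin d → ℂ) :
    ∃ u : EuclideanSpace ℂ (Fin d), ‖u‖ = 1 ∧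
      ∀ a, φ a = ‖(WithLp.toLp 2 φ : EuclideanSpace ℂ (Fin d))‖ * u a := by
  set f : EuclideanSpace ℂ (Fin d) := WithLp.toLp 2 φ with hf
  by_cases h0 : f = 0
  -- Any unit vector serves here: a vanishing partial amplitude has outcome probability zero.
  · refine ⟨EuclideanSpace.single ⟨0, hd⟩ 1, by simp, fun a => ?_⟩
    have : φ = 0 := congrArg WithLp.ofLp h0
    simp [h0, this]
  · have hf0 : ‖f‖ ≠ 0 := norm_ne_zero_iff.mpr h0
    refine ⟨(‖f‖⁻¹ : ℂ) • f, by simp [norm_smul, hf0], fun a => ?_⟩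
    have h1 : (‖f‖ : ℂ) ≠ 0 := by exact_mod_cast hf0
    rw [PiLp.smul_apply, smul_eq_mul, mul_inv_cancel_left₀ h1]

/-- A unit vector in the direction of `φ`. -/
noncomputable def unitVec (hd : 0 < d) (φ : Fin d → ℂ) : EuclideanSpace ℂ (Fin d) :=
  (exists_unit_vector hd φ).choose

theorem norm_unitVec (hd : 0 < d) (φ : Fin d → ℂ) : ‖unitVec hd φ‖ = 1 :=
  (exists_unit_vector hd φ).choose_spec.1

theorem sum_normSq_of_norm_eq_one {u : EuclideanSpace ℂ (Fin d)} (hu : ‖u‖ = 1) :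
    ∑ a, normSq (u a) = 1 := by
  have := EuclideanSpace.norm_sq_eq u
  rw [hu, one_pow] at this
  simp [normSq_eq_norm_sq, ← this]

omit [Fintype Ω] [DecidableEq Ω] in
theorem normSq_overlap_unitVec (hd : 0 < d) (φ : Fin d → ℂ) (m : Ω → Fin d → ℂ) (o : Ω) :
    (∑ a, normSq (φ a)) * normSq (overlap m o (unitVec hd φ)) = normSq (overlap m o φ) := by
  have h1 := (exists_unit_vector hd φ).choose_spec.2
  have h2 : overlap m o φ = ‖(WithLp.toLp 2 φ : EuclideanSpace ℂ (Fin d))‖ *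
      overlap m o (unitVec hd φ) := by
    simp only [overlap, mul_sum]
    exact sum_congr rfl fun a _ => by
      rw [h1 a, unitVec]
      ring
  rw [h2, normSq_mul, normSq_ofReal, ← sq, EuclideanSpace.norm_sq_eq]
  simp [normSq_eq_norm_sq]

/-- The probability of the outcomes `k`, given that the outcomes at the sites in `C` are `z`. -/
noncomputable def condWeight (m : Ω → Fin d → ℂ) (ψ : QuditSpace V d) (C : Finset V) (z : C → Ω)
    (k : V → Ω) : ℝ :=
  (if outcomesOn C k = z then outcomeProb m ψ k else 0) / prob (outcomeProb m ψ) (outcomesOn C) z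

theorem condWeight_nonneg (m : Ω → Fin d → ℂ) (ψ : QuditSpace V d) (C : Finset V) (z : C → Ω)
    (k : V → Ω) : 0 ≤ condWeight m ψ C z k := by
  refine div_nonneg ?_ (prob_nonneg (outcomeProb_nonneg m ψ) _ _)
  split_ifs <;> simp [outcomeProb_nonneg]

theorem sum_condWeight (m : Ω → Fin d → ℂ) (ψ : QuditSpace V d) (C : Finset V) (z : C → Ω)
    (hz : prob (outcomeProb m ψ) (outcomesOn C) z ≠ 0) : ∑ k, condWeight m ψ C z k = 1 := by
  simp only [condWeight, ← sum_div]
  rw [div_eq_one_iff_eq hz]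
  unfold prob
  exact sum_congr rfl fun x _ => by congr

/-- The state of particle `v` after the other particles were found in the states `m (k u)`. -/
noncomputable def localState (hd : 0 < d) (m : Ω → Fin d → ℂ) (ψ : QuditSpace V d) (k : V → Ω)
    (v : V) : EuclideanSpace ℂ (Fin d) :=
  unitVec hd (partialAmp m ψ k v)

/-- Summing out `k i` gives the squared norm of the partial amplitude, which cancels the
normalisation of the local state. Thus the pure local states, averaged, have the correct conditional
outcome law; `hi` lets site `i` be resampled without changing `z`. -/
theorem sum_condWeight_mul_normSq_overlap [Nonempty Ω] (hd : 0 < d) {m : Ω → Fin d → ℂ}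
    (hm : ∀ a b, ∑ o, m o a * conj (m o b) = if a = b then 1 else 0) (ψ : QuditSpace V d)
    {C : Finset V} {i : V} (hi : i ∉ C) (o : Ω) (z : C → Ω) :
    ∑ k, condWeight m ψ C z k * normSq (overlap m o (localState hd m ψ k i))
      = prob (outcomeProb m ψ) (fun x => (x i, outcomesOn C x)) (o, z)
        / prob (outcomeProb m ψ) (outcomesOn C) z := by
  have hc : (Fintype.card Ω : ℝ) ≠ 0 := by exact_mod_cast Fintype.card_ne_zero
  simp only [condWeight, div_mul_eq_mul_div, ← sum_div]
  congr 1
  refine mul_left_cancel₀ hc ?_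
  rw [card_mul_prob_outcome m ψ hi, ← sum_sum_update _ i]
  refine sum_congr rfl fun k _ => ?_
  simp only [outcomesOn_update hi, localState, partialAmp_update, outcomeProb, amp_update]
  rw [← sum_mul]
  split_ifs
  · rw [sum_normSq_overlap hm, normSq_overlap_unitVec]
  · simp

/-- The average of `F` over the product states whose factors are drawn independently, given the
outcomes at the sites in `C`. -/
noncomputable def mixAvg (hd : 0 < d) (m : Ω → Fin d → ℂ) (ψ : QuditSpace V d) (C : Finset V)
    (F : (V → EuclideanSpace ℂ (Fin d)) → ℝ) : ℝ :=
  ∑ z : C → Ω, ∑ κ : V → V → Ω, prob (outcomeProb m ψ) (outcomesOn C) z *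
    (∏ v, condWeight m ψ C z (κ v)) * F fun v => localState hd m ψ (κ v) v

theorem mixAvg_mono (hd : 0 < d) (m : Ω → Fin d → ℂ) (ψ : QuditSpace V d) (C : Finset V)
    {F F' : (V → EuclideanSpace ℂ (Fin d)) → ℝ}
    (h : ∀ φ : V → EuclideanSpace ℂ (Fin d), (∀ v, ‖φ v‖ = 1) → F φ ≤ F' φ) :
    mixAvg hd m ψ C F ≤ mixAvg hd m ψ C F' := by
  refine sum_le_sum fun z _ => sum_le_sum fun κ _ => ?_
  refine mul_le_mul_of_nonneg_left (h _ fun v => norm_unitVec hd _) ?_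
  exact mul_nonneg (prob_nonneg (outcomeProb_nonneg m ψ) _ _)
    (prod_nonneg fun v _ => condWeight_nonneg m ψ C z _)

theorem mixAvg_const (hd : 0 < d) {m : Ω → Fin d → ℂ}
    (hm : ∀ a b, ∑ o, m o a * conj (m o b) = if a = b then 1 else 0) {ψ : QuditSpace V d}
    (hψ : ‖ψ‖ = 1) (C : Finset V) (r : ℝ) : mixAvg hd m ψ C (fun _ => r) = r := by
  simp only [mixAvg, ← sum_mul, ← mul_sum]
  rw [sum_congr rfl fun z _ => by rw [sum_prod_eq_prod_sum fun _ => condWeight m ψ C z]]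
  have h1 : ∀ z : C → Ω, prob (outcomeProb m ψ) (outcomesOn C) z *
      ∏ _v : V, ∑ k, condWeight m ψ C z k = prob (outcomeProb m ψ) (outcomesOn C) z := by
    intro z
    by_cases hz : prob (outcomeProb m ψ) (outcomesOn C) z = 0
    · rw [hz, zero_mul]
    · simp [sum_condWeight m ψ C z hz]
  rw [sum_congr rfl fun z _ => h1 z, sum_prob]
  simp only [outcomeProb]
  rw [sum_normSq_amp hm, hψ]
  ring

theorem mixAvg_sum (hd : 0 < d) (m : Ω → Fin d → ℂ) (ψ : QuditSpace V d) (C : Finset V)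
    {ι : Type*} (s : Finset ι) (F : ι → (V → EuclideanSpace ℂ (Fin d)) → ℝ) :
    mixAvg hd m ψ C (fun φ => ∑ e ∈ s, F e φ) = ∑ e ∈ s, mixAvg hd m ψ C (F e) := by
  simp only [mixAvg, mul_sum]
  rw [sum_congr rfl fun z _ => sum_comm, sum_comm]

theorem exists_le_mixAvg (hd : 0 < d) {m : Ω → Fin d → ℂ}
    (hm : ∀ a b, ∑ o, m o a * conj (m o b) = if a = b then 1 else 0) {ψ : QuditSpace V d}
    (hψ : ‖ψ‖ = 1) (C : Finset V) (F : (V → EuclideanSpace ℂ (Fin d)) → ℝ) :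
    ∃ φ : V → EuclideanSpace ℂ (Fin d), (∀ v, ‖φ v‖ = 1) ∧ F φ ≤ mixAvg hd m ψ C F := by
  by_contra! hF
  set r := mixAvg hd m ψ C F with hr
  have h0 := mixAvg_const hd hm hψ C r
  have h1 := mixAvg_const hd hm hψ C 1
  have h2 : ∀ z : C → Ω, ∀ κ : V → V → Ω, prob (outcomeProb m ψ) (outcomesOn C) z *
      (∏ v, condWeight m ψ C z (κ v)) * (r - F fun v => localState hd m ψ (κ v) v) ≤ 0 := by
    intro z κ
    refine mul_nonpos_of_nonneg_of_nonpos ?_ ?_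
    · exact mul_nonneg (prob_nonneg (outcomeProb_nonneg m ψ) _ _)
        (prod_nonneg fun v _ => condWeight_nonneg m ψ C z _)
    · exact sub_nonpos.mpr (hF _ fun v => norm_unitVec hd _).le
  have h3 : ∑ z : C → Ω, ∑ κ : V → V → Ω, prob (outcomeProb m ψ) (outcomesOn C) z *
      (∏ v, condWeight m ψ C z (κ v)) * (r - F fun v => localState hd m ψ (κ v) v) = 0 := by
    simp only [mul_sub, sum_sub_distrib]
    rw [sub_eq_zero]
    exact h0.trans hr
  have h4 : ∀ z : C → Ω, ∀ κ : V → V → Ω, prob (outcomeProb m ψ) (outcomesOn C) z *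
      (∏ v, condWeight m ψ C z (κ v)) = 0 := by
    intro z κ
    have h5 := (sum_eq_zero_iff_of_nonpos fun z _ => sum_nonpos fun κ _ => h2 z κ).mp h3 z
      (mem_univ z)
    have h6 := (sum_eq_zero_iff_of_nonpos fun κ _ => h2 z κ).mp h5 κ (mem_univ κ)
    refine (mul_eq_zero.mp h6).resolve_right (sub_ne_zero.mpr ?_)
    exact (hF _ fun v => norm_unitVec hd _).ne
  simp [mixAvg, h4] at h1

/-- Each site `v` has its own full configuration `κ v`, so given `z` the factors at `i` and `j` are
independent and the two conditional laws multiply. -/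
theorem mixAvg_two_site [Nonempty Ω] (hd : 0 < d) {m : Ω → Fin d → ℂ}
    (hm : ∀ a b, ∑ o, m o a * conj (m o b) = if a = b then 1 else 0) (ψ : QuditSpace V d)
    {C : Finset V} {i j : V} (hij : i ≠ j) (hi : i ∉ C) (hj : j ∉ C) (g : Ω → Ω → ℝ) :
    mixAvg hd m ψ C (fun φ => ∑ o, ∑ o', g o o' *
        (normSq (overlap m o (φ i)) * normSq (overlap m o' (φ j))))
      = ∑ t, condProd (outcomeProb m ψ) (fun x => x i) (fun x => x j) (outcomesOn C) t *
        g t.1 t.2.1 := by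
  simp only [mixAvg, Fintype.sum_prod_type]
  rw [sum_comm_cycle]
  refine sum_congr rfl fun z _ => ?_
  set p := prob (outcomeProb m ψ) (outcomesOn C) z with hp
  by_cases hz : p = 0
  · simp [condProd, ← hp, hz]
  have h1 : ∀ o o' : Ω, ∑ κ : V → V → Ω, (∏ v, condWeight m ψ C z (κ v)) *
      (normSq (overlap m o (localState hd m ψ (κ i) i))
        * normSq (overlap m o' (localState hd m ψ (κ j) j)))
      = (prob (outcomeProb m ψ) (fun x => (x i, outcomesOn C x)) (o, z) / p) *
        (prob (outcomeProb m ψ) (fun x => (x j, outcomesOn C x)) (o', z) / p) := by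
    intro o o'
    rw [sum_congr rfl fun κ _ => mul_comm _ _, sum_two_site hij
      (fun k k' => normSq (overlap m o (localState hd m ψ k i))
        * normSq (overlap m o' (localState hd m ψ k' j))) fun _ => condWeight m ψ C z]
    simp only [sum_condWeight m ψ C z hz, prod_const_one, mul_one, hp]
    rw [← sum_condWeight_mul_normSq_overlap hd hm ψ hi, ← sum_condWeight_mul_normSq_overlap hd hm
      ψ hj, sum_mul_sum]
    exact sum_congr rfl fun _ _ => sum_congr rfl fun _ _ => by ring
  simp only [mul_sum]
  rw [sum_comm_cycle, sum_comm_cycle]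
  refine sum_congr rfl fun o _ => sum_congr rfl fun o' _ => ?_
  calc _ = p * g o o' * ∑ κ : V → V → Ω, (∏ v, condWeight m ψ C z (κ v)) *
      (normSq (overlap m o (localState hd m ψ (κ i) i))
        * normSq (overlap m o' (localState hd m ψ (κ j) j))) := by
        rw [mul_sum]
        exact sum_congr rfl fun _ _ => by ring
    _ = _ := by
        rw [h1]
        simp only [condProd, ← hp]
        field_simp

theorem expectation_productVector_of_isDual {m : Ω → Fin d → ℂ}
    (hm : ∀ a b, ∑ o, m o a * conj (m o b) = if a = b then 1 else 0) {A : QuditOp V d} {i j : V}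
    (hij : i ≠ j) {h : Ω → Ω → ℂ} (hA : IsDual m A i j h) {φ : V → EuclideanSpace ℂ (Fin d)}
    (hφ : ∀ v, ‖φ v‖ = 1) : expectation A (productVector φ) = ∑ o, ∑ o', (h o o').re *
      (normSq (overlap m o (φ i)) * normSq (overlap m o' (φ j))) := by
  rw [expectation_eq_of_isDual hm hij hA]
  simp only [amp_productVector, map_prod]
  rw [sum_two_site hij (fun o o' => (h o o').re) fun v o => normSq (overlap m o (φ v))]
  simp only [sum_normSq_overlap hm, sum_normSq_of_norm_eq_one (hφ _), prod_const_one, mul_one]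

/-- The single bound `hS` controls both second moments: that of `ψ` through its two-particle fibres,
and that of the mixture by testing on `φ i ⊗ φ j`. -/
theorem mixAvg_expectation_le [Nonempty Ω] (hd : 0 < d) {m : Ω → Fin d → ℂ}
    (hm : ∀ a b, ∑ o, m o a * conj (m o b) = if a = b then 1 else 0) {ψ : QuditSpace V d}
    (hψ : ‖ψ‖ = 1) {C : Finset V} {i j : V} (hij : i ≠ j) (hi : i ∉ C) (hj : j ∉ C)
    {A : QuditOp V d} {h : Ω → Ω → ℂ} (hA : IsDual m A i j h) {S : ℝ}
    (hS : ∀ χ, ∑ o, ∑ o', normSq (h o o') * normSq (overlapTwo m o o' χ)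
      ≤ S * ∑ a, ∑ b, normSq (χ a b)) :
    mixAvg hd m ψ C (fun φ => expectation A (productVector φ)) ≤ expectation A ψ +
      √(4 * S * condMutualInfo (outcomeProb m ψ) (fun x => x i) (fun x => x j)
        (outcomesOn C)) := by
  have hS' : ∀ χ, ∑ o, ∑ o', (h o o').re ^ 2 * normSq (overlapTwo m o o' χ)
      ≤ S * ∑ a, ∑ b, normSq (χ a b) := fun χ =>
    (sum_le_sum fun o _ => sum_le_sum fun o' _ => mul_le_mul_of_nonneg_right
      (by rw [normSq_apply]; nlinarith [mul_self_nonneg (h o o').im]) (normSq_nonneg _)).trans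
      (hS χ)
  have h1 : mixAvg hd m ψ C (fun φ => expectation A (productVector φ))
      ≤ ∑ t, condProd (outcomeProb m ψ) (fun x => x i) (fun x => x j) (outcomesOn C) t *
        (h t.1 t.2.1).re := by
    rw [← mixAvg_two_site hd hm ψ hij hi hj fun o o' => (h o o').re]
    exact mixAvg_mono hd m ψ C fun φ hφ =>
      (expectation_productVector_of_isDual hm hij hA hφ).le
  have h2 := sum_condProd_sub_le_sqrt_condMutualInfo (outcomeProb_nonneg m ψ) (fun x => x i)
    (fun x => x j) (outcomesOn C) (fun t => (h t.1 t.2.1).re) (S := S) ?_ ?_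
  · rw [expectation_eq_of_isDual hm hij hA ψ]
    have : ∑ x : V → Ω, (h (x i) (x j)).re * normSq (amp m ψ x)
        = ∑ x, outcomeProb m ψ x * (h (x i) (x j)).re :=
      sum_congr rfl fun _ _ => mul_comm _ _
    rw [this]
    linarith
  · have := sum_outcomeProb_mul_le hm ψ hij (fun o o' => (h o o').re ^ 2) S hS'
    simpa [outcomeProb, sum_normSq_amp hm, hψ] using this
  · rw [← mixAvg_two_site hd hm ψ hij hi hj fun o o' => (h o o').re ^ 2]
    refine (mixAvg_mono hd m ψ C fun φ hφ => ?_).trans (mixAvg_const hd hm hψ C S).le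
    have h3 := hS' fun a b => φ i a * φ j b
    have h4 : ∀ o o', overlapTwo m o o' (fun a b => φ i a * φ j b)
        = overlap m o (φ i) * overlap m o' (φ j) := by
      intro o o'
      simp only [overlapTwo, overlap, sum_mul_sum]
      exact sum_congr rfl fun _ _ => sum_congr rfl fun _ _ => by ring
    simp only [h4, normSq_mul, ← mul_sum, sum_normSq_of_norm_eq_one (hφ _), mul_one] at h3
    exact h3

end Mixture

end

/-! ### From local operators on all sites to two-particle operators -/

section

open Finset Complex ComplexConjugate

section Locality

variable {V : Type*} [Fintype V] [DecidableEq V] {d : ℕ}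

/-- The configuration with values `a` at `i`, `b` at `j` and `0` elsewhere. -/
def pairConfig (hd : 0 < d) (i j : V) (p : Fin d × Fin d) : V → Fin d :=
  Function.update (Function.update (fun _ => ⟨0, hd⟩) j p.2) i p.1

omit [Fintype V] in
theorem pairConfig_left (hd : 0 < d) (i j : V) (p : Fin d × Fin d) :
    pairConfig hd i j p i = p.1 := by
  simp [pairConfig]

omit [Fintype V] in
theorem pairConfig_right (hd : 0 < d) {i j : V} (hij : i ≠ j) (p : Fin d × Fin d) :
    pairConfig hd i j p j = p.2 := by
  simp [pairConfig, hij.symm]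

omit [Fintype V] in
theorem pairConfig_of_ne (hd : 0 < d) {i j v : V} (hi : v ≠ i) (hj : v ≠ j)
    (p : Fin d × Fin d) : pairConfig hd i j p v = ⟨0, hd⟩ := by
  simp [pairConfig, hi, hj]

omit [Fintype V] in
theorem pairConfig_injective (hd : 0 < d) {i j : V} (hij : i ≠ j) :
    Function.Injective (pairConfig hd i j) := by
  intro p q h
  refine Prod.ext ?_ ?_
  · rw [← pairConfig_left hd i j p, h, pairConfig_left]
  · rw [← pairConfig_right hd hij p, h, pairConfig_right hd hij]

/-- The two-particle operator with matrix elements those of `A` between configurations which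
vanish off `i` and `j`. -/
def pairElement (hd : 0 < d) (A : QuditOp V d) (i j : V) (a b a' b' : Fin d) : ℂ :=
  A (pairConfig hd i j (a, b)) (pairConfig hd i j (a', b'))

theorem apply_eq_pairElement (hd : 0 < d) {A : QuditOp V d} {i j : V} (hij : i ≠ j)
    (hA : ActsOnlyOn {v : V | v ∈ s(i, j)} A) (y y' : V → Fin d) :
    A y y' = if ∀ v, v ≠ i → v ≠ j → y v = y' v then
      pairElement hd A i j (y i) (y j) (y' i) (y' j) else 0 := by
  obtain ⟨K, hK⟩ := hA
  have h1 : ∀ y : V → Fin d, (fun s : {v : V | v ∈ s(i, j)} => pairConfig hd i j (y i, y j) s)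
      = fun s : {v : V | v ∈ s(i, j)} => y s := by
    intro y
    ext ⟨s, hs⟩
    rcases Sym2.mem_iff.mp hs with rfl | rfl
    · simp [pairConfig_left]
    · simp [pairConfig_right hd hij]
  have h2 : ∀ y y' : V → Fin d, (∀ v, v ∉ {v : V | v ∈ s(i, j)} → y v = y' v)
      ↔ ∀ v, v ≠ i → v ≠ j → y v = y' v := by
    intro y y'
    simp [and_imp]
  rw [pairElement, hK, hK, h1, h1]
  simp only [h2]
  split_ifs with h3 h4
  · rfl
  · exact absurd (fun v hi hj => by rw [pairConfig_of_ne hd hi hj, pairConfig_of_ne hd hi hj]) h4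
  · rfl

omit [Fintype V] in
theorem conj_pairElement (hd : 0 < d) {A : QuditOp V d} (hA : A.IsHermitian) (i j : V)
    (a b a' b' : Fin d) :
    conj (pairElement hd A i j a b a' b') = pairElement hd A i j a' b' a b :=
  hA.apply _ _

theorem norm_apply_le (A : QuditOp V d) (ψ : QuditSpace V d) :
    ‖Matrix.toEuclideanCLM (𝕜 := ℂ) A ψ‖ ≤ opNorm A * ‖ψ‖ :=
  ContinuousLinearMap.le_opNorm _ _

/-- The vector `χ` is placed on the configurations that vanish off `i` and `j`, an isometric
embedding; the two-particle block is then a compression of `A`. -/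
theorem sum_normSq_applyTwo_pairElement_le (hd : 0 < d) {A : QuditOp V d} (hA : opNorm A ≤ 1)
    {i j : V} (hij : i ≠ j) (χ : Fin d → Fin d → ℂ) :
    ∑ a, ∑ b, normSq (applyTwo (pairElement hd A i j) χ a b) ≤ ∑ a, ∑ b, normSq (χ a b) := by
  have hinj := pairConfig_injective hd hij
  let ψ : QuditSpace V d :=
    WithLp.toLp 2 (Function.extend (pairConfig hd i j) (fun p => χ p.1 p.2) 0)
  have hψ : ∀ p, ψ (pairConfig hd i j p) = χ p.1 p.2 := fun p =>
    hinj.extend_apply (fun p => χ p.1 p.2) 0 p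
  have hψ0 : ∀ y, y ∉ Set.range (pairConfig hd i j) → ψ y = 0 := fun y hy =>
    Function.extend_apply' (fun p : Fin d × Fin d => χ p.1 p.2) (0 : (V → Fin d) → ℂ) y hy
  have h1 : ‖ψ‖ ^ 2 = ∑ a, ∑ b, normSq (χ a b) := by
    rw [EuclideanSpace.norm_sq_eq, ← Fintype.sum_prod_type']
    refine (Fintype.sum_of_injective _ hinj _ _ (fun y hy => ?_) fun p => ?_).symm
    · simp [hψ0 y hy]
    · rw [hψ, normSq_eq_norm_sq]
  have h2 : ∀ p : Fin d × Fin d, Matrix.toEuclideanCLM (𝕜 := ℂ) A ψ (pairConfig hd i j p)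
      = applyTwo (pairElement hd A i j) χ p.1 p.2 := by
    intro p
    rw [Matrix.ofLp_toEuclideanCLM, Matrix.mulVec, dotProduct, applyTwo,
      ← Fintype.sum_prod_type' (f := fun a' b' => pairElement hd A i j p.1 p.2 a' b' * χ a' b')]
    refine (Fintype.sum_of_injective _ hinj _ _ (fun y hy => ?_) fun q => ?_).symm
    · rw [hψ0 y hy, mul_zero]
    · rw [hψ, pairElement]
  have h3 : ‖Matrix.toEuclideanCLM (𝕜 := ℂ) A ψ‖ ^ 2 ≤ ‖ψ‖ ^ 2 := by
    refine pow_le_pow_left₀ (norm_nonneg _) ((norm_apply_le A ψ).trans ?_) 2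
    exact mul_le_of_le_one_left (norm_nonneg _) hA
  rw [← h1, ← Fintype.sum_prod_type' (f := fun a b =>
    normSq (applyTwo (pairElement hd A i j) χ a b))]
  refine le_trans ?_ h3
  rw [EuclideanSpace.norm_sq_eq]
  calc _ = ∑ y ∈ univ.map ⟨_, hinj⟩, ‖Matrix.toEuclideanCLM (𝕜 := ℂ) A ψ y‖ ^ 2 := by
        rw [sum_map]
        exact sum_congr rfl fun p _ => by
          rw [Function.Embedding.coeFn_mk, h2, normSq_eq_norm_sq]
    _ ≤ _ := sum_le_univ_sum_of_nonneg fun y => sq_nonneg _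

theorem isDual_phaseCoeff (hd : 0 < d) {A : QuditOp V d} {i j : V} (hij : i ≠ j)
    (hA : ActsOnlyOn {v : V | v ∈ s(i, j)} A) :
    IsDual phaseVec A i j (phaseCoeff (pairElement hd A i j)) := by
  intro y y'
  rw [apply_eq_pairElement hd hij hA, sum_phaseCoeff_mul]

theorem abs_expectation_le {A : QuditOp V d} (hA : opNorm A ≤ 1) {ψ : QuditSpace V d}
    (hψ : ‖ψ‖ = 1) : |expectation A ψ| ≤ 1 := by
  refine (abs_re_le_norm _).trans ((norm_inner_le_norm _ _).trans ?_)
  have := norm_apply_le A ψ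
  rw [hψ] at this ⊢
  linarith

theorem norm_productVector {φ : V → EuclideanSpace ℂ (Fin d)} (hφ : ∀ v, ‖φ v‖ = 1) :
    ‖productVector φ‖ = 1 := by
  have : ‖productVector φ‖ ^ 2 = 1 := by
    rw [EuclideanSpace.norm_sq_eq]
    simp only [productVector, norm_prod, ← prod_pow]
    rw [sum_prod_eq_prod_sum fun v a => ‖φ v a‖ ^ 2]
    simp [← EuclideanSpace.norm_sq_eq, hφ]
  exact (pow_eq_one_iff_of_nonneg (norm_nonneg _) two_ne_zero).mp this

theorem mixAvg_expectation_le_one {Ω : Type*} [Fintype Ω] [DecidableEq Ω] (hd : 0 < d)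
    {m : Ω → Fin d → ℂ} (hm : ∀ a b, ∑ o, m o a * conj (m o b) = if a = b then 1 else 0)
    {ψ : QuditSpace V d} (hψ : ‖ψ‖ = 1) (C : Finset V) {A : QuditOp V d} (hA : opNorm A ≤ 1) :
    mixAvg hd m ψ C (fun φ => expectation A (productVector φ)) ≤ 1 :=
  (mixAvg_mono hd m ψ C fun _ hφ =>
    (abs_le.mp (abs_expectation_le hA (norm_productVector hφ))).2).trans
    (mixAvg_const hd hm hψ C 1).le

end Locality

/-! ### Greedy choice of the conditioning set -/

section Chain

variable {V Ω : Type*} [Fintype V] [DecidableEq V] [Fintype Ω] [DecidableEq Ω] {d : ℕ}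

-- Greedy insertion with a telescoping potential. The chosen site may already lie in the set, so the
-- cardinality is only bounded by the number of steps.
omit [Fintype V] in
theorem exists_chain {Φ J : Finset V → ℝ} (h : ∀ C, ∃ v, J C ≤ Φ (insert v C) - Φ C) :
    ∃ C : ℕ → Finset V, (∀ k, #(C k) ≤ k) ∧
      ∀ n, ∑ k ∈ range n, J (C k) ≤ Φ (C n) - Φ ∅ := by
  choose f hf using h
  refine ⟨fun k => Nat.rec ∅ (fun _ C => insert (f C) C) k, fun k => ?_, fun n => ?_⟩
  · induction k with
    | zero => simp
    | succ k ih => exact (card_insert_le _ _).trans (Nat.succ_le_succ ih)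
  · induction n with
    | zero => simp
    | succ n ih =>
      rw [sum_range_succ]
      exact (add_le_add ih (hf _)).trans (le_of_eq (by simp))

omit [Fintype V] [DecidableEq V] [Fintype Ω] [DecidableEq Ω] in
theorem outcomesOn_eq_iff {C : Finset V} {x y : V → Ω} :
    outcomesOn C x = outcomesOn C y ↔ ∀ v ∈ C, x v = y v := by
  simp [funext_iff, outcomesOn]

theorem condMutualInfo_comm {X A B Z : Type*} [Fintype X] (P : X → ℝ) (a : X → A) (b : X → B)
    (c : X → Z) : condMutualInfo P a b c = condMutualInfo P b a c := by
  unfold condMutualInfo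
  rw [ent_congr P (f := fun x => (a x, b x, c x)) (g := fun x => (b x, a x, c x))
    fun x y => by simp only [Prod.mk.injEq]; tauto]
  ring

/-- The mutual information of the outcome at `i` and the outcomes at the other sites in `C`. -/
noncomputable def siteInfo (P : (V → Ω) → ℝ) (i : V) (C : Finset V) : ℝ :=
  ent P (fun x => x i) + ent P (outcomesOn (C.erase i)) - ent P (outcomesOn (insert i C))

omit [DecidableEq Ω] in
theorem ent_outcomesOn_insert (P : (V → Ω) → ℝ) (i : V) (C : Finset V) :
    ent P (outcomesOn (insert i C)) = ent P fun x => (x i, outcomesOn (C.erase i) x) := by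
  refine ent_congr P fun x y => ?_
  simp only [outcomesOn_eq_iff, Prod.mk.injEq, mem_insert, mem_erase]
  grind

omit [DecidableEq Ω] in
theorem siteInfo_empty {P : (V → Ω) → ℝ} (hP : ∑ x, P x = 1) (i : V) : siteInfo P i ∅ = 0 := by
  have h1 : ent P (outcomesOn (∅ : Finset V)) = 0 := by
    have : ∀ x, prob P (outcomesOn (∅ : Finset V)) (outcomesOn ∅ x) = 1 := by
      intro x
      rw [← hP]
      exact sum_congr rfl fun y _ => if_pos (outcomesOn_eq_iff.mpr (by simp))
    simp [ent, this]
  have h2 : ent P (outcomesOn (insert i (∅ : Finset V))) = ent P fun x => x i :=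
    ent_congr P fun x y => by simp [outcomesOn_eq_iff]
  rw [siteInfo, erase_empty, h1, h2]
  ring

-- The chain rule for mutual information. Erasing `i` in `siteInfo` makes it valid for `i ∈ C` too,
-- so the potential can be summed over all sites.
omit [DecidableEq Ω] in
theorem siteInfo_insert_sub {P : (V → Ω) → ℝ} {i v : V} {C : Finset V} (hiv : i ≠ v) :
    siteInfo P i (insert v C) - siteInfo P i C
      = condMutualInfo P (fun x => x i) (fun x => x v) (outcomesOn (C.erase i)) := by
  have h1 : ent P (outcomesOn ((insert v C).erase i))
      = ent P fun x => (x v, outcomesOn (C.erase i) x) := by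
    refine ent_congr P fun x y => ?_
    simp only [outcomesOn_eq_iff, Prod.mk.injEq, mem_insert, mem_erase]
    grind
  have h2 : ent P (outcomesOn (insert i (insert v C)))
      = ent P fun x => (x i, x v, outcomesOn (C.erase i) x) := by
    refine ent_congr P fun x y => ?_
    simp only [outcomesOn_eq_iff, Prod.mk.injEq, mem_insert, mem_erase]
    grind
  rw [siteInfo, siteInfo, condMutualInfo, h1, h2, ent_outcomesOn_insert]
  ring

omit [DecidableEq Ω] in
theorem siteInfo_le_insert {P : (V → Ω) → ℝ} (hP : ∀ x, 0 ≤ P x) (i v : V) (C : Finset V) :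
    0 ≤ siteInfo P i (insert v C) - siteInfo P i C := by
  by_cases hiv : i = v
  · subst hiv
    rw [siteInfo, siteInfo, erase_insert_eq_erase, insert_idem, sub_self]
  · rw [siteInfo_insert_sub hiv]
    exact condMutualInfo_nonneg hP _ _ _

theorem siteInfo_le_log [Nonempty Ω] (hd : 0 < d) {m : Ω → Fin d → ℂ}
    (hm : ∀ a b, ∑ o, m o a * conj (m o b) = if a = b then 1 else 0) {ψ : QuditSpace V d}
    (hψ : ‖ψ‖ = 1) (i : V) (C : Finset V) :
    siteInfo (outcomeProb m ψ) i C ≤ Real.log d := by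
  rw [siteInfo, ent_outcomesOn_insert]
  refine ent_add_ent_sub_ent_le_log (outcomeProb_nonneg m ψ) ?_ _ _
    (fun o => ∑ a, normSq (m o a)) (by exact_mod_cast hd)
    (fun o => sum_nonneg fun a _ => normSq_nonneg _) (sum_sum_normSq hm)
    fun o z => prob_outcome_le hm ψ (notMem_erase i C) o z
  simp [outcomeProb, sum_normSq_amp hm, hψ]

/-- The mutual information of the outcomes at the two sites of the pair `p`, given the outcomes
at the sites in `C`, or `0` if the pair meets `C`. -/
noncomputable def pairInfo (P : (V → Ω) → ℝ) (C : Finset V) (p : V × V) : ℝ :=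
  if p.1 ∈ C ∨ p.2 ∈ C then 0
  else condMutualInfo P (fun x => x p.1) (fun x => x p.2) (outcomesOn C)

omit [DecidableEq Ω] in
theorem pairInfo_nonneg {P : (V → Ω) → ℝ} (hP : ∀ x, 0 ≤ P x) (C : Finset V) (p : V × V) :
    0 ≤ pairInfo P C p := by
  unfold pairInfo
  split_ifs
  · exact le_rfl
  · exact condMutualInfo_nonneg hP _ _ _

omit [DecidableEq Ω] in
theorem pairInfo_swap (P : (V → Ω) → ℝ) (C : Finset V) (p : V × V) :
    pairInfo P C p.swap = pairInfo P C p := by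
  unfold pairInfo
  rw [condMutualInfo_comm]
  simp [or_comm]

omit [DecidableEq Ω] in
theorem pairInfo_le {P : (V → Ω) → ℝ} (hP : ∀ x, 0 ≤ P x) (C : Finset V) {p : V × V}
    (hp : p.1 ≠ p.2) :
    pairInfo P C p ≤ siteInfo P p.1 (insert p.2 C) - siteInfo P p.1 C := by
  unfold pairInfo
  split_ifs with h
  · exact siteInfo_le_insert hP _ _ _
  · rw [not_or] at h
    rw [siteInfo_insert_sub hp, erase_eq_of_notMem h.1]

/-- Each edge supplies two distinct ordered pairs, and different edges supply disjoint ones; all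
remaining ordered pairs are dropped because `F` is nonnegative. -/
theorem two_mul_sum_edge_le {G : SimpleGraph V} [DecidableRel G.Adj] {r : Sym2 V → V × V}
    (hr : ∀ e, s((r e).1, (r e).2) = e) {f : V × V → ℝ} {F : V → V → ℝ}
    (hf : ∀ p, f p.swap = f p) (hF : ∀ i v, 0 ≤ F i v)
    (hfF : ∀ p : V × V, p.1 ≠ p.2 → f p ≤ F p.1 p.2) :
    2 * ∑ e ∈ G.edgeFinset, f (r e) ≤ ∑ i, ∑ v, F i v := by
  have hne : ∀ e ∈ G.edgeFinset, (r e).1 ≠ (r e).2 := by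
    intro e he
    rw [SimpleGraph.mem_edgeFinset, ← hr e, SimpleGraph.mem_edgeSet] at he
    exact he.ne
  have hinj : ∀ e e', r e = r e' → e = e' := fun e e' h => by rw [← hr e, h, hr e']
  have hdisj : Disjoint (G.edgeFinset.image r) (G.edgeFinset.image fun e => (r e).swap) := by
    rw [disjoint_left]
    intro p hp hp'
    obtain ⟨e, he, rfl⟩ := mem_image.mp hp
    obtain ⟨e', he', h⟩ := mem_image.mp hp'
    have h2 : e' = e := by
      rw [← hr e, ← h, ← hr e', Prod.fst_swap, Prod.snd_swap, hr e', Sym2.eq_swap, hr e']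
    subst h2
    exact hne e' he (congrArg Prod.snd h)
  calc _ = ∑ e ∈ G.edgeFinset, f (r e) + ∑ e ∈ G.edgeFinset, f (r e).swap := by
        simp only [hf]
        ring
    _ ≤ ∑ e ∈ G.edgeFinset, F (r e).1 (r e).2 + ∑ e ∈ G.edgeFinset, F (r e).swap.1 (r e).swap.2 :=
        add_le_add (sum_le_sum fun e he => hfF _ (hne e he))
          (sum_le_sum fun e he => hfF _ (hne e he).symm)
    _ = ∑ p ∈ G.edgeFinset.image r ∪ G.edgeFinset.image fun e => (r e).swap, F p.1 p.2 := by
        rw [sum_union hdisj, sum_image fun e _ e' _ h => hinj e e' h,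
          sum_image fun e _ e' _ h => hinj e e' (Prod.swap_injective h)]
    _ ≤ ∑ p : V × V, F p.1 p.2 := sum_le_univ_sum_of_nonneg fun p => hF _ _
    _ = _ := Fintype.sum_prod_type _

/-- Averaged over a uniform site `v`, the gain of the potential is at least `2 / n` times the sum of
the edge informations, so some `v` attains that much. The potential starts at 0 and never exceeds `n
log d`. -/
theorem exists_chain_pairInfo [Nonempty V] [Nonempty Ω] (hd : 0 < d) {m : Ω → Fin d → ℂ}
    (hm : ∀ a b, ∑ o, m o a * conj (m o b) = if a = b then 1 else 0) {ψ : QuditSpace V d}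
    (hψ : ‖ψ‖ = 1) (G : SimpleGraph V) [DecidableRel G.Adj] {r : Sym2 V → V × V}
    (hr : ∀ e, s((r e).1, (r e).2) = e) :
    ∃ C : ℕ → Finset V, (∀ k, #(C k) ≤ k) ∧ ∀ n, ∑ k ∈ range n, 2 / (Fintype.card V : ℝ) *
      ∑ e ∈ G.edgeFinset, pairInfo (outcomeProb m ψ) (C k) (r e)
        ≤ Fintype.card V * Real.log d := by
  have hP := outcomeProb_nonneg m ψ
  have hn : (0 : ℝ) < Fintype.card V := by exact_mod_cast Fintype.card_pos
  have hP1 : ∑ x, outcomeProb m ψ x = 1 := by simp [outcomeProb, sum_normSq_amp hm, hψ]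
  obtain ⟨C, hC, hC'⟩ := exists_chain (Φ := fun C => ∑ i, siteInfo (outcomeProb m ψ) i C)
    (J := fun C => 2 / (Fintype.card V : ℝ) *
      ∑ e ∈ G.edgeFinset, pairInfo (outcomeProb m ψ) C (r e)) fun C => by
    have h1 := two_mul_sum_edge_le (G := G) hr (pairInfo_swap (outcomeProb m ψ) C)
      (fun i v => siteInfo_le_insert hP i v C) fun p hp => pairInfo_le hP C hp
    by_contra! h2
    have h3 := sum_lt_sum_of_nonempty (univ_nonempty (α := V)) fun v _ => h2 v
    simp only [← sum_sub_distrib, sum_const, card_univ, nsmul_eq_mul] at h3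
    rw [sum_comm] at h3
    refine absurd (h1.trans_lt h3) (not_lt.mpr (le_of_eq ?_))
    field_simp
  refine ⟨C, hC, fun n => (hC' n).trans ?_⟩
  simp only [siteInfo_empty hP1, sum_const_zero, sub_zero]
  exact (sum_le_sum fun i _ => siteInfo_le_log hd hm hψ i _).trans (by simp)

/-- Some `k` does no worse than the average of the combined loss: the linear part averages to `c (n
- 1)`, and Cauchy-Schwarz bounds the average of the square roots. -/
theorem exists_lt_loss_le {n : ℕ} (hn : 0 < n) {c b : ℝ} {J : ℕ → ℝ}
    (hJ : ∀ k, 0 ≤ J k) {L : ℝ} (hL : ∑ k ∈ range n, J k ≤ L) (hb : 0 ≤ b) :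
    ∃ k < n, 2 * c * k + √(b * J k) ≤ c * (n - 1 : ℕ) + √(b * L / n) := by
  have hn' : (0 : ℝ) < n := by exact_mod_cast hn
  have h1 : ∑ k ∈ range n, √(b * J k) ≤ n * √(b * L / n) := by
    have h2 : (∑ k ∈ range n, √(b * J k)) ^ 2 ≤ (n * √(b * L / n)) ^ 2 := by
      have hL0 : 0 ≤ L := (sum_nonneg fun k _ => hJ k).trans hL
      refine sq_sum_le_card_mul_sum_sq.trans ?_
      rw [sum_congr rfl fun k _ => Real.sq_sqrt (mul_nonneg hb (hJ k)), ← mul_sum, card_range,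
        mul_pow, Real.sq_sqrt (by positivity)]
      calc _ ≤ n * (b * L) := by gcongr
        _ = _ := by field_simp
    exact le_of_sq_le_sq h2 (by positivity)
  have h3 : ∑ k ∈ range n, (2 * c * k) = n * (c * (n - 1 : ℕ)) := by
    have h4 := congrArg (Nat.cast (R := ℝ)) (Finset.sum_range_id_mul_two n)
    simp only [Nat.cast_mul, Nat.cast_sum, Nat.cast_ofNat] at h4
    rw [← mul_sum]
    linear_combination c * h4
  obtain ⟨k, hk, h⟩ := exists_le_of_sum_le (s := range n) (by simpa using hn.ne')
    (f := fun k => 2 * c * k + √(b * J k)) (g := fun _ => c * (n - 1 : ℕ) + √(b * L / n)) (by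
      rw [sum_add_distrib, h3, sum_const, card_range, nsmul_eq_mul, mul_add]
      linarith)
  exact ⟨k, mem_range.mp hk, h⟩

end Chain

/-! ### Summing the losses over the edges -/

section Energy

variable {V : Type*} [Fintype V] [DecidableEq V] {d : ℕ}

theorem expectation_edgeAverage (G : SimpleGraph V) [DecidableRel G.Adj] (h : Sym2 V → QuditOp V d)
    (ψ : QuditSpace V d) : expectation (edgeAverage G h) ψ
      = 1 / (#G.edgeFinset : ℝ) * ∑ e ∈ G.edgeFinset, expectation (h e) ψ := by
  simp only [expectation, edgeAverage, map_smul, map_sum, smul_apply,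
    _root_.sum_apply, inner_smul_right, inner_sum]
  rw [show (1 / (#G.edgeFinset : ℂ)) = ((1 / (#G.edgeFinset : ℝ) : ℝ) : ℂ) by push_cast; rfl,
    re_ofReal_mul, re_sum]

theorem card_filter_edge_le {G : SimpleGraph V} [DecidableRel G.Adj] {D : ℕ}
    (hG : G.IsRegularOfDegree D) {r : Sym2 V → V × V} (hr : ∀ e, s((r e).1, (r e).2) = e)
    (C : Finset V) : #{e ∈ G.edgeFinset | (r e).1 ∈ C ∨ (r e).2 ∈ C} ≤ #C * D := by
  refine (card_le_card (t := C.biUnion fun v => G.incidenceFinset v) fun e he => ?_).trans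
    (card_biUnion_le_card_mul _ _ _ fun v _ => by
      rw [SimpleGraph.card_incidenceFinset_eq_degree, hG.degree_eq])
  obtain ⟨he, h⟩ := mem_filter.mp he
  rw [SimpleGraph.mem_edgeFinset] at he
  have h1 : (r e).1 ∈ e := by
    have := Sym2.mem_mk_left (r e).1 (r e).2
    rwa [hr e] at this
  have h2 : (r e).2 ∈ e := by
    have := Sym2.mem_mk_right (r e).1 (r e).2
    rwa [hr e] at this
  rw [mem_biUnion]
  rcases h with h | h
  · exact ⟨_, h, by rw [SimpleGraph.mem_incidenceFinset]; exact ⟨he, h1⟩⟩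
  · exact ⟨_, h, by rw [SimpleGraph.mem_incidenceFinset]; exact ⟨he, h2⟩⟩

/-- Energies lie in `[-1, 1]`, so an edge meeting `C` loses at most 2. For the others, `96 = 4 * 24`
joins the Hellinger constant to the second moment bound. -/
theorem mixAvg_edge_le (hd : 0 < d) {ψ : QuditSpace V d} (hψ : ‖ψ‖ = 1) (C : Finset V)
    {A : QuditOp V d} {p : V × V} (hp : p.1 ≠ p.2) (hA : A.IsHermitian)
    (hA1 : ActsOnlyOn {v : V | v ∈ s(p.1, p.2)} A) (hA2 : opNorm A ≤ 1) :
    mixAvg hd phaseVec ψ C (fun φ => expectation A (productVector φ)) ≤ expectation A ψ +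
      ((if p.1 ∈ C ∨ p.2 ∈ C then 2 else 0)
        + √(96 * (d : ℝ) ^ 2 * pairInfo (outcomeProb phaseVec ψ) C p)) := by
  unfold pairInfo
  split_ifs with h
  · have h1 := mixAvg_expectation_le_one hd sum_phaseVec_mul_conj hψ C hA2
    have h2 := (abs_le.mp (abs_expectation_le hA2 hψ)).1
    simp
    linarith
  · rw [not_or] at h
    have h1 := mixAvg_expectation_le hd sum_phaseVec_mul_conj hψ hp h.1 h.2
      (isDual_phaseCoeff hd hp hA1) (sum_normSq_phaseCoeff_mul_le (conj_pairElement hd hA _ _)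
        (sum_normSq_applyTwo_pairElement_le hd hA2 hp))
    rw [zero_add]
    convert h1 using 4
    ring

/-- At most `#C * D` of the `n D / 2` edges meet `C`, each losing 2, which gives `4 #C / n`.
Cauchy-Schwarz moves the average over edges inside the square root. -/
theorem exists_product_energy_le {G : SimpleGraph V} [DecidableRel G.Adj] {D : ℕ} (hd : 0 < d)
    (hD : 0 < D) [Nonempty V] (hG : G.IsRegularOfDegree D) {h : Sym2 V → QuditOp V d}
    (h_herm : ∀ e ∈ G.edgeFinset, (h e).IsHermitian)
    (h_local : ∀ e ∈ G.edgeFinset, ActsOnlyOn {v : V | v ∈ e} (h e))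
    (h_norm : ∀ e ∈ G.edgeFinset, opNorm (h e) ≤ 1) {ψ : QuditSpace V d} (hψ : ‖ψ‖ = 1)
    {r : Sym2 V → V × V} (hr : ∀ e, s((r e).1, (r e).2) = e) (C : Finset V) :
    ∃ φ : V → EuclideanSpace ℂ (Fin d), (∀ v, ‖φ v‖ = 1) ∧
      expectation (edgeAverage G h) (productVector φ) ≤ expectation (edgeAverage G h) ψ
        + (4 / Fintype.card V * #C + √(96 * (d : ℝ) ^ 2 / D * (2 / Fintype.card V *
          ∑ e ∈ G.edgeFinset, pairInfo (outcomeProb phaseVec ψ) C (r e)))) := by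
  have hn : (0 : ℝ) < Fintype.card V := by exact_mod_cast Fintype.card_pos
  have hD' : (0 : ℝ) < D := by exact_mod_cast hD
  have hN : (Fintype.card V : ℝ) * D = 2 * #G.edgeFinset := by
    have : Fintype.card V * D = 2 * #G.edgeFinset := by
      rw [← G.sum_degrees_eq_twice_card_edges]
      simp [hG.degree_eq]
    exact_mod_cast this
  have hN' : (0 : ℝ) < #G.edgeFinset := by
    have := mul_pos hn hD'
    linarith
  obtain ⟨φ, hφ, h1⟩ := exists_le_mixAvg hd sum_phaseVec_mul_conj hψ C
    fun φ => ∑ e ∈ G.edgeFinset, expectation (h e) (productVector φ)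
  refine ⟨φ, hφ, ?_⟩
  rw [mixAvg_sum] at h1
  have h2 : ∀ e ∈ G.edgeFinset, mixAvg hd phaseVec ψ C
      (fun φ => expectation (h e) (productVector φ)) ≤ expectation (h e) ψ +
      ((if (r e).1 ∈ C ∨ (r e).2 ∈ C then 2 else 0)
        + √(96 * (d : ℝ) ^ 2 * pairInfo (outcomeProb phaseVec ψ) C (r e))) := by
    intro e he
    refine mixAvg_edge_le hd hψ C ?_ (h_herm e he) ?_ (h_norm e he)
    · rw [SimpleGraph.mem_edgeFinset, ← hr e, SimpleGraph.mem_edgeSet] at he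
      exact he.ne
    · rw [hr e]
      exact h_local e he
  have h3 := h1.trans (sum_le_sum h2)
  rw [sum_add_distrib, sum_add_distrib, ← sum_filter, sum_const, nsmul_eq_mul] at h3
  have h4 : (#{e ∈ G.edgeFinset | (r e).1 ∈ C ∨ (r e).2 ∈ C} : ℝ) ≤ #C * D := by
    exact_mod_cast card_filter_edge_le hG hr C
  have h5 : ∑ e ∈ G.edgeFinset, √(96 * (d : ℝ) ^ 2 * pairInfo (outcomeProb phaseVec ψ) C (r e))
      ≤ #G.edgeFinset * √(96 * (d : ℝ) ^ 2 / D * (2 / Fintype.card V *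
          ∑ e ∈ G.edgeFinset, pairInfo (outcomeProb phaseVec ψ) C (r e))) := by
    have h6 := fun e => pairInfo_nonneg (outcomeProb_nonneg phaseVec ψ) C (r e)
    have h7 : 0 ≤ ∑ e ∈ G.edgeFinset, pairInfo (outcomeProb phaseVec ψ) C (r e) :=
      sum_nonneg fun e _ => h6 e
    refine le_of_sq_le_sq ?_ (by positivity)
    refine sq_sum_le_card_mul_sum_sq.trans (le_of_eq ?_)
    rw [sum_congr rfl fun e _ => Real.sq_sqrt (mul_nonneg (by positivity) (h6 e)), ← mul_sum,
      mul_pow, Real.sq_sqrt (by positivity)]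
    have h8 : (#G.edgeFinset : ℝ) = Fintype.card V * D / 2 := by linarith
    rw [h8]
    field_simp
  rw [expectation_edgeAverage, expectation_edgeAverage]
  calc _ ≤ 1 / (#G.edgeFinset : ℝ) * (∑ e ∈ G.edgeFinset, expectation (h e) ψ + (#C * D * 2 +
        #G.edgeFinset * √(96 * (d : ℝ) ^ 2 / D * (2 / Fintype.card V *
          ∑ e ∈ G.edgeFinset, pairInfo (outcomeProb phaseVec ψ) C (r e))))) := by
        gcongr
        linarith
    _ = _ := by
        have h8 : (#G.edgeFinset : ℝ) = Fintype.card V * D / 2 := by linarith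
        rw [h8]
        field_simp
        ring

end Energy

end

/-! ### Choice of the number of conditioning steps -/

theorem mainTheorem4 {V : Type*} [Fintype V] [DecidableEq V] [Nonempty V]
    (G : SimpleGraph V) [DecidableRel G.Adj] (D d : ℕ) (hD : 0 < D) (hd : 0 < d)
    (hG : G.IsRegularOfDegree D)
    (h : Sym2 V → QuditOp V d)
    (h_herm : ∀ e ∈ G.edgeFinset, (h e).IsHermitian)
    (h_local : ∀ e ∈ G.edgeFinset, ActsOnlyOn {v : V | v ∈ e} (h e))
    (h_norm : ∀ e ∈ G.edgeFinset, opNorm (h e) ≤ 1) :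
    ∃ φ : V → EuclideanSpace ℂ (Fin d), (∀ v, ‖φ v‖ = 1) ∧
      (edgeAverage G h * pureDensity (productVector φ)).trace.re
        ≤ groundEnergy (edgeAverage G h)
          + 12 * ((d : ℝ) ^ 2 * Real.log d / D) ^ (1 / 3 : ℝ) := by
  have hn : (0 : ℝ) < Fintype.card V := by exact_mod_cast Fintype.card_pos
  have hD' : (0 : ℝ) < D := by exact_mod_cast hD
  have hlog : 0 ≤ Real.log d := Real.log_natCast_nonneg d
  set a : ℝ := (d : ℝ) ^ 2 * Real.log d / D with ha
  have ha0 : 0 ≤ a := by positivity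
  set t : ℝ := a ^ (1 / 3 : ℝ) with ht
  have ht0 : 0 ≤ t := Real.rpow_nonneg ha0 _
  have ht3 : t ^ 3 = a := by
    rw [ht, ← Real.rpow_natCast, ← Real.rpow_mul ha0]
    norm_num
  obtain ⟨ψ, hψ, hψE⟩ := (isLeast_groundEnergy hd (edgeAverage G h)).1
  have hψ1 : ‖ψ‖ = 1 := hψ
  have hr : ∀ e : Sym2 V, ∃ p : V × V, s(p.1, p.2) = e := fun e => ⟨Quot.out e, Quot.out_eq e⟩
  choose r hr using hr
  obtain ⟨C, hC, hinfo⟩ := exists_chain_pairInfo hd sum_phaseVec_mul_conj hψ1 G hr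
  -- About `2 t` conditioning steps per site balance the losses: at most `4 t` from edges meeting
  -- `C`, and `√48 t ≤ 8 t` from correlations. The `+ 1` keeps `n` positive when `t = 0` and is
  -- harmless, since the first loss involves `n - 1`.
  set n : ℕ := ⌊2 * t * Fintype.card V⌋₊ + 1 with hn_def
  have h1 : ((n - 1 : ℕ) : ℝ) ≤ 2 * t * Fintype.card V :=
    Nat.floor_le (by positivity)
  have h2 : 2 * t * Fintype.card V < n := by
    rw [hn_def]
    push_cast
    exact Nat.lt_floor_add_one _
  obtain ⟨k, -, hk⟩ := exists_lt_loss_le (n := n) (Nat.succ_pos _)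
    (c := 2 / (Fintype.card V : ℝ)) (b := 96 * (d : ℝ) ^ 2 / D)
    (fun k => mul_nonneg (by positivity) (Finset.sum_nonneg fun e _ =>
      pairInfo_nonneg (outcomeProb_nonneg phaseVec ψ) (C k) (r e))) (hinfo n) (by positivity)
  obtain ⟨φ, hφ, hE⟩ := exists_product_energy_le hd hD hG h_herm h_local h_norm hψ1 hr (C k)
  refine ⟨φ, hφ, ?_⟩
  rw [sum_conj_mul_mul_eq_trace, ← expectation_eq, ← hψE]
  refine hE.trans (add_le_add_right ?_ _)
  have h3 : 4 / (Fintype.card V : ℝ) * (C k).card ≤ 2 * (2 / (Fintype.card V : ℝ)) * k := by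
    have : ((C k).card : ℝ) ≤ k := by exact_mod_cast hC k
    calc _ ≤ 4 / (Fintype.card V : ℝ) * k := by gcongr
      _ = _ := by ring
  have h4 : 2 / (Fintype.card V : ℝ) * (n - 1 : ℕ) ≤ 4 * t := by
    calc _ ≤ 2 / (Fintype.card V : ℝ) * (2 * t * Fintype.card V) := by gcongr
      _ = _ := by field_simp; ring
  have h5 : √(96 * (d : ℝ) ^ 2 / D * (Fintype.card V * Real.log d) / n) ≤ 8 * t := by
    refine Real.sqrt_le_iff.mpr ⟨by positivity, ?_⟩
    have hn0 : (0 : ℝ) < n := by positivity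
    rw [div_le_iff₀ hn0]
    calc _ = 96 * Fintype.card V * a := by rw [ha]; field_simp
      _ = 48 * t ^ 2 * (2 * t * Fintype.card V) := by rw [← ht3]; ring
      _ ≤ 48 * t ^ 2 * n := by gcongr
      _ ≤ 64 * t ^ 2 * n := by gcongr; norm_num
      _ = _ := by ring
  linarith
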